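/- Let $\mathfrak h$ be the real Lie algebra with basis $X_1,X_2,X_3$ and brackets $[X_1,X_2]=X_2$, $[X_1,X_3]=-X_3$, $[X_2,X_3]=0$, let $H$ be the connected and simply connected Lie group with Lie algebra $\mathfrak h$, and identify $\mathfrak h^*$ with $\mathbb R^3$ by the coordinates $x_i$ associated with $X_i$. Let $\Omega=\{x\in\mathfrak h^*: x_2^2+x_3^2\neq 0\}$, with the Lie–Poisson bivector $\Lambda_x(\xi,\eta)=\langle x,[\xi,\eta]\rangle$, and let $H_{x_1}=x_2\partial_2-x_3\partial_3$ be the derivation $\{x_1,\cdot\}$ on functions of $(x_2,x_3)$. Let $I(\Omega)$ be the algebra of smooth Casimir functions on $\Omega$. Let $H^k_\Lambda(\Omega)$ be the cohomology of the complex of smooth multivector fields on $\Omega$ with coboundary $\sigma=[\Lambda,\cdot\,]$ (Schouten bracket), and $H^k_{\Lambda,tan}(\Omega)$ the cohomology of its subcomplex of multivector fields tangent to the symplectic leaves; these are $I(\Omega)$-modules. Call such a module infinite dimensional if it is infinite dimensional as a real vector space and is finitely generated neither over the ring of $H$-invariant polynomial functions on $\mathfrak h^*$ nor over the ring of $H$-invariant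 real analytic functions on $\mathfrak h^*$ (both rings act through restriction to $\Omega$). Then the following hold. 1. $\Omega$ is the union of the $2$-dimensional coadjoint orbits of $H$ in $\mathfrak h^*$. 2. $H^0_{\Lambda,tan}(\Omega)\cong I(\Omega)$, the module $H^1_{\Lambda,tan}(\Omega)$ is infinite dimensional, and $H^k_{\Lambda,tan}(\Omega)=0$ for all $k>1$. 3. Put $\beta=x_2\,dx_3+x_3\,dx_2$ and $X=\dfrac{x_2\partial_3+x_3\partial_2}{x_2^2+x_3^2}$. There are isomorphisms of $I(\Omega)$-modules $$H^0_\Lambda(\Omega)\cong I(\Omega),\qquad H^1_\Lambda(\Omega)\cong H^1_{\Lambda,tan}(\Omega)\oplus I(\Omega)X,\qquad H^2_\Lambda(\Omega)\cong H^1_{\Lambda,tan}(\Omega),$$ and the second one can be chosen so that it sends the class of a tangential cocycle $A$ to $([A],0)$, and so that the component in $I(\Omega)X$ of the image of a class $[Q]$ is the transverse part $\beta(Q)X$ of $Q$. In particular $H^1_\Lambda(\Omega)$ and $H^2_\Lambda(\Omega)$ are infinite dimensional. Moreover $H^k_\Lambda(\Omega)=0$ for all $k\ge 3$. 4. Let $a,g\in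 C^\infty(\Omega)$ depend only on $(x_2,x_3)$ and satisfy $H_{x_1}g=a$. For $u>0$ and $v\in\mathbb R$ let $\varphi(u,v)$ be the unique point $(x_2,x_3)$ with $x_2,x_3>0$, $x_2x_3=u$ and $\tfrac12(x_2^2-x_3^2)=v$. Then, with $A=a\circ\varphi$, the limit $$\lim_{u\to0^+}\int_{-1}^{1}\frac{A(u,t)}{2\sqrt{u^2+t^2}}\,dt$$ exists in $\mathbb R$. -/

import Mathlib

open scoped ContDiff

set_option maxSynthPendingDepth 3

namespace LiePoissonH

/-! ### The Lie algebra and its dual -/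

/-- The three-dimensional real Lie algebra with basis `X₁, X₂, X₃` and brackets
`[X₁, X₂] = X₂`, `[X₁, X₃] = -X₃`, `[X₂, X₃] = 0`. An element is its coordinate vector with
respect to that basis; indices are shifted by one, so `i : Fin 3` is the index of `X_{i+1}`. -/
def 𝔥 : Type := Fin 3 → ℝ

instance : NormedAddCommGroup 𝔥 := inferInstanceAs (NormedAddCommGroup (Fin 3 → ℝ))

noncomputable instance : NormedSpace ℝ 𝔥 := inferInstanceAs (NormedSpace ℝ (Fin 3 → ℝ))

instance : FiniteDimensional ℝ 𝔥 := inferInstanceAs (FiniteDimensional ℝ (Fin 3 → ℝ))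

@[ext] theorem 𝔥.ext {a b : 𝔥} (h : ∀ i, a i = b i) : a = b := funext h

@[simp] theorem 𝔥.add_apply (a b : 𝔥) (i : Fin 3) : (a + b) i = a i + b i := rfl

@[simp] theorem 𝔥.neg_apply (a : 𝔥) (i : Fin 3) : (-a) i = -a i := rfl

@[simp] theorem 𝔥.zero_apply (i : Fin 3) : (0 : 𝔥) i = 0 := rfl

@[simp] theorem 𝔥.smul_apply (c : ℝ) (a : 𝔥) (i : Fin 3) : (c • a) i = c * a i := rfl

noncomputable instance : Bracket 𝔥 𝔥 :=
  ⟨fun a b => ![0, a 0 * b 1 - a 1 * b 0, -(a 0 * b 2 - a 2 * b 0)]⟩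

@[simp] theorem bracket_zero_apply (a b : 𝔥) : ⁅a, b⁆ 0 = 0 := rfl

@[simp] theorem bracket_one_apply (a b : 𝔥) : ⁅a, b⁆ 1 = a 0 * b 1 - a 1 * b 0 := rfl

@[simp] theorem bracket_two_apply (a b : 𝔥) : ⁅a, b⁆ 2 = -(a 0 * b 2 - a 2 * b 0) := rfl

noncomputable instance : LieRing 𝔥 where
  add_lie a b c := by ext i; fin_cases i <;> simp <;> ring
  lie_add a b c := by ext i; fin_cases i <;> simp <;> ring
  lie_self a := by ext i; fin_cases i <;> simp <;> ring
  leibniz_lie a b c := by ext i; fin_cases i <;> simp <;> ring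

noncomputable instance : LieAlgebra ℝ 𝔥 where
  lie_smul t a b := by ext i; fin_cases i <;> simp <;> ring

/-- The basis vectors `X₁, X₂, X₃` (as `X 0, X 1, X 2`). -/
def X (i : Fin 3) : 𝔥 := fun j => if j = i then 1 else 0

theorem bracket_basis : ⁅X 0, X 1⁆ = X 1 ∧ ⁅X 0, X 2⁆ = -X 2 ∧ ⁅X 1, X 2⁆ = 0 := by
  refine ⟨?_, ?_, ?_⟩ <;> ext i <;> fin_cases i <;> simp [X]

/-- The dual `𝔥*`, identified with `ℝ³` by the coordinates `x_i(ℓ) = ℓ(X_i)`. -/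
abbrev Dual : Type := Fin 3 → ℝ

/-- The duality pairing `⟨x, Y⟩` of `𝔥*` with `𝔥`. -/
def pairing (x : Dual) (Y : 𝔥) : ℝ := ∑ i, x i * Y i

/-- The Lie bracket as a continuous bilinear map. -/
noncomputable def lieCLM : 𝔥 →L[ℝ] 𝔥 →L[ℝ] 𝔥 :=
  LinearMap.toContinuousLinearMap
    ((LinearMap.toContinuousLinearMap (𝕜 := ℝ) (E := 𝔥) (F' := 𝔥)).toLinearMap ∘ₗ
      LinearMap.mk₂ ℝ (fun a b : 𝔥 => ⁅a, b⁆) add_lie smul_lie lie_add (fun c a b => lie_smul c a b))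

@[simp] theorem lieCLM_apply (a b : 𝔥) : lieCLM a b = ⁅a, b⁆ := rfl

/-! ### The coadjoint action -/

/-- The coadjoint representation: `(ad*_ξ x)(Y) = -⟨x, [ξ, Y]⟩`. -/
noncomputable def coad (ξ : 𝔥) : Dual →L[ℝ] Dual :=
  LinearMap.toContinuousLinearMap
    { toFun := fun x i => -pairing x ⁅ξ, X i⁆
      map_add' := fun x y => by
        ext i; simp only [pairing, Pi.add_apply, add_mul, Finset.sum_add_distrib]; ring
      map_smul' := fun c x => by
        ext i
        simp only [pairing, Pi.smul_apply, smul_eq_mul, mul_assoc, ← Finset.mul_sum,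
          RingHom.id_apply]
        ring }

/-- The coadjoint action of the group element `exp ξ`, `ξ ∈ 𝔥`. -/
noncomputable def coAd (ξ : 𝔥) : Dual →L[ℝ] Dual := NormedSpace.exp (coad ξ)

/-- The orbit of `x` under the coadjoint action of the connected and simply connected Lie group
of `𝔥`: such a group is generated by the elements `exp ξ`. -/
def coadjointOrbit (x : Dual) : Set Dual := {y | ∃ l : List 𝔥, y = (l.map coAd).prod x}

/-- The dimension of the coadjoint orbit of `x`, i.e. of its tangent space `{ad*_ξ x | ξ ∈ 𝔥}`
at `x`. -/
noncomputable def orbitDim (x : Dual) : ℕ :=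
  Module.finrank ℝ (Submodule.span ℝ (Set.range fun ξ : 𝔥 => coad ξ x))

/-- The open set `Ω = {x₂² + x₃² ≠ 0}` of `𝔥*`. -/
def Ω : Set Dual := {x | x 1 ^ 2 + x 2 ^ 2 ≠ 0}

theorem isOpen_Ω : IsOpen Ω :=
  isOpen_ne_fun (by fun_prop) continuous_const

/-! ### The Lie–Poisson structure

The cotangent space of `𝔥*` at every point is `(𝔥*)* = 𝔥`, with `dx_i = X_i`. -/

/-- The Poisson bivector `Λ_x(ξ, η) = ⟨x, [ξ, η]⟩` of `𝔥*`. -/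
noncomputable def Λ (x : Dual) (ξ η : 𝔥) : ℝ := pairing x ⁅ξ, η⁆

/-- The map `# : T*_x → T_x` with `⟨η, ξ^#⟩ = Λ_x(ξ, η)`. -/
noncomputable def sharp (x : Dual) : 𝔥 →L[ℝ] Dual :=
  LinearMap.toContinuousLinearMap
    { toFun := fun ξ i => Λ x ξ (X i)
      map_add' := fun a b => by
        ext i; simp only [Λ, pairing, add_lie, 𝔥.add_apply, mul_add, Finset.sum_add_distrib,
          Pi.add_apply]
      map_smul' := fun c a => by
        ext i
        simp only [Λ, pairing, smul_lie, 𝔥.smul_apply, Pi.smul_apply, smul_eq_mul,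
          RingHom.id_apply, Finset.mul_sum]
        exact Finset.sum_congr rfl fun j _ => by ring }

theorem sharp_apply (x : Dual) (ξ : 𝔥) (i : Fin 3) : sharp x ξ i = Λ x ξ (X i) := rfl

theorem sharp_smooth : ContDiff ℝ ∞ sharp := by
  have h : sharp = LinearMap.toContinuousLinearMap (𝕜 := ℝ) (E := Dual) (F' := 𝔥 →L[ℝ] Dual)
      { toFun := sharp
        map_add' := fun x y => by
          ext ξ i
          simp [sharp_apply, Λ, pairing, add_mul, Finset.sum_add_distrib]
        map_smul' := fun c x => by
          ext ξ i
          simp [sharp_apply, Λ, pairing, Finset.mul_sum, mul_assoc] } := rfl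
  rw [h]
  exact ContinuousLinearMap.contDiff _

/-! ### Smooth maps on `Ω` -/

/-- Extension by zero, used only to differentiate at points of the open set `Ω`. -/
noncomputable def ext0 {W : Type*} [Zero W] (Q : Ω → W) : Dual → W :=
  Function.extend Subtype.val Q 0

@[simp] theorem ext0_coe {W : Type*} [Zero W] (Q : Ω → W) (x : Ω) : ext0 Q x = Q x :=
  Subtype.val_injective.extend_apply Q 0 x

/-- Smoothness (`C^∞`) of a map defined on the open set `Ω`. -/
def Smooth {W : Type*} [NormedAddCommGroup W] [NormedSpace ℝ W] (Q : Ω → W) : Prop :=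
  ContDiffOn ℝ ∞ (ext0 Q) Ω

theorem Smooth.congr {W : Type*} [NormedAddCommGroup W] [NormedSpace ℝ W] {Q : Ω → W}
    {F : Dual → W} (hF : ContDiffOn ℝ ∞ F Ω) (h : ∀ x : Ω, Q x = F x) : Smooth Q :=
  ContDiffOn.congr hF fun x hx => by rw [← h ⟨x, hx⟩]; exact ext0_coe Q ⟨x, hx⟩

theorem Smooth.diffAt {W : Type*} [NormedAddCommGroup W] [NormedSpace ℝ W] {Q : Ω → W}
    (h : Smooth Q) (x : Ω) : DifferentiableAt ℝ (ext0 Q) x :=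
  (ContDiffOn.contDiffAt h (isOpen_Ω.mem_nhds x.2)).differentiableAt (by simp)

/-- The derivative at a point of `Ω`. -/
noncomputable def D {W : Type*} [NormedAddCommGroup W] [NormedSpace ℝ W] (Q : Ω → W) (x : Ω) :
    Dual →L[ℝ] W :=
  fderiv ℝ (ext0 Q) x

theorem D_eq {W : Type*} [NormedAddCommGroup W] [NormedSpace ℝ W] {Q : Ω → W} {F : Dual → W}
    (h : ∀ x : Ω, Q x = F x) (x : Ω) : D Q x = fderiv ℝ F x := by
  refine Filter.EventuallyEq.fderiv_eq ?_
  filter_upwards [isOpen_Ω.mem_nhds x.2] with y hy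
  rw [← h ⟨y, hy⟩]; exact ext0_coe Q ⟨y, hy⟩

theorem Smooth.add {W : Type*} [NormedAddCommGroup W] [NormedSpace ℝ W] {P Q : Ω → W}
    (hP : Smooth P) (hQ : Smooth Q) : Smooth (P + Q) :=
  Smooth.congr (ContDiffOn.add hP hQ) fun x => by simp

theorem Smooth.smul {W : Type*} [NormedAddCommGroup W] [NormedSpace ℝ W] {f : Ω → ℝ} {Q : Ω → W}
    (hf : Smooth f) (hQ : Smooth Q) : Smooth (f • Q) :=
  Smooth.congr (ContDiffOn.smul hf hQ) fun x => by simp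

theorem Smooth.const {W : Type*} [NormedAddCommGroup W] [NormedSpace ℝ W] (w : W) :
    Smooth (fun _ => w) :=
  Smooth.congr (F := fun _ => w) contDiffOn_const fun _ => rfl

theorem D_add {W : Type*} [NormedAddCommGroup W] [NormedSpace ℝ W] {P Q : Ω → W}
    (hP : Smooth P) (hQ : Smooth Q) (x : Ω) : D (P + Q) x = D P x + D Q x := by
  rw [D_eq (F := ext0 P + ext0 Q) (fun x => by simp)]
  exact fderiv_add (hP.diffAt x) (hQ.diffAt x)

theorem D_smul {W : Type*} [NormedAddCommGroup W] [NormedSpace ℝ W] {f : Ω → ℝ} {Q : Ω → W}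
    (hf : Smooth f) (hQ : Smooth Q) (x : Ω) :
    D (f • Q) x = f x • D Q x + (D f x).smulRight (Q x) := by
  rw [D_eq (F := fun y => ext0 f y • ext0 Q y) (fun x => by simp)]
  rw [fderiv_fun_smul (hf.diffAt x) (hQ.diffAt x)]
  simp [D]

theorem D_const {W : Type*} [NormedAddCommGroup W] [NormedSpace ℝ W] (w : W) (x : Ω) :
    D (fun _ : Ω => w) x = 0 := by
  rw [D_eq (F := fun _ => w) (fun _ => rfl)]; simp

theorem Smooth.D {W : Type*} [NormedAddCommGroup W] [NormedSpace ℝ W] {Q : Ω → W}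
    (h : Smooth Q) : Smooth (D Q) :=
  Smooth.congr (F := fderiv ℝ (ext0 Q)) (ContDiffOn.fderiv_of_isOpen h isOpen_Ω (by simp))
    fun _ => rfl

theorem Smooth.neg {W : Type*} [NormedAddCommGroup W] [NormedSpace ℝ W] {Q : Ω → W}
    (hQ : Smooth Q) : Smooth (-Q) := by
  have h := (Smooth.const (-1 : ℝ)).smul hQ
  rwa [show ((fun _ => (-1 : ℝ)) : Ω → ℝ) • Q = -Q from by ext1 x; simp] at h

theorem D_neg {W : Type*} [NormedAddCommGroup W] [NormedSpace ℝ W] {Q : Ω → W} (x : Ω) :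
    D (-Q) x = -D Q x := by
  rw [D_eq (F := -ext0 Q) (fun x => by simp)]
  exact fderiv_neg

/-- The Casimir functions on `Ω`: the smooth functions whose Hamiltonian vector field vanishes,
i.e. `df(ξ^#) = 0` for every covector `ξ`. They form the algebra `I(Ω)`. -/
@[ext] structure Cas where
  /-- the underlying function -/
  val : Ω → ℝ
  smooth : Smooth val
  casimir : ∀ (x : Ω) (ξ : 𝔥), D val x (sharp x ξ) = 0

namespace Cas

noncomputable instance : Zero Cas := ⟨⟨fun _ => 0, Smooth.const 0, fun x ξ => by simp [D_const]⟩⟩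

noncomputable instance : One Cas := ⟨⟨fun _ => 1, Smooth.const 1, fun x ξ => by simp [D_const]⟩⟩

noncomputable instance : Add Cas := ⟨fun f g => ⟨f.val + g.val, f.smooth.add g.smooth,
  fun x ξ => by simp [D_add f.smooth g.smooth, f.casimir, g.casimir]⟩⟩

noncomputable instance : Neg Cas := ⟨fun f => ⟨-f.val, f.smooth.neg,
  fun x ξ => by simp [D_neg, f.casimir]⟩⟩

noncomputable instance : Mul Cas := ⟨fun f g => ⟨f.val • g.val, f.smooth.smul g.smooth,
  fun x ξ => by rw [D_smul f.smooth g.smooth]; simp [f.casimir, g.casimir]⟩⟩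

@[simp] theorem zero_val (x : Ω) : (0 : Cas).val x = 0 := rfl

@[simp] theorem one_val (x : Ω) : (1 : Cas).val x = 1 := rfl

@[simp] theorem add_val (f g : Cas) (x : Ω) : (f + g).val x = f.val x + g.val x := rfl

@[simp] theorem neg_val (f : Cas) (x : Ω) : (-f).val x = -f.val x := rfl

@[simp] theorem mul_val (f g : Cas) (x : Ω) : (f * g).val x = f.val x * g.val x := rfl

noncomputable instance : CommRing Cas where
  add_assoc f g h := by ext x; simp [add_assoc]
  zero_add f := by ext x; simp
  add_zero f := by ext x; simp
  add_comm f g := by ext x; simp [add_comm]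
  neg_add_cancel f := by ext x; simp
  mul_assoc f g h := by ext x; simp [mul_assoc]
  one_mul f := by ext x; simp
  mul_one f := by ext x; simp
  mul_comm f g := by ext x; simp [mul_comm]
  left_distrib f g h := by ext x; simp [mul_add]
  right_distrib f g h := by ext x; simp [add_mul]
  zero_mul f := by ext x; simp
  mul_zero f := by ext x; simp
  nsmul := nsmulRec
  zsmul := zsmulRec

noncomputable instance : Algebra ℝ Cas :=
  RingHom.toAlgebra
    { toFun := fun r => ⟨fun _ => r, Smooth.const r, fun x ξ => by simp [D_const]⟩
      map_one' := rfl
      map_mul' := fun _ _ => rfl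
      map_zero' := rfl
      map_add' := fun _ _ => rfl }

@[simp] theorem algebraMap_val (r : ℝ) (x : Ω) : (algebraMap ℝ Cas r).val x = r := rfl

end Cas

/-- The ring `S(𝔥)^H` of `H`-invariant polynomial functions on `𝔥*`, acting through restriction
to `Ω`. -/
noncomputable def polyInv : Subalgebra ℝ Cas where
  carrier := {f | ∃ p : MvPolynomial (Fin 3) ℝ,
    (∀ (ξ : 𝔥) (x : Dual), MvPolynomial.eval (coAd ξ x) p = MvPolynomial.eval x p) ∧
    ∀ x : Ω, f.val x = MvPolynomial.eval x.1 p}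
  mul_mem' := by
    rintro f g ⟨p, hp, hfp⟩ ⟨q, hq, hgq⟩
    exact ⟨p * q, fun ξ x => by simp [hp, hq], fun x => by simp [hfp, hgq]⟩
  add_mem' := by
    rintro f g ⟨p, hp, hfp⟩ ⟨q, hq, hgq⟩
    exact ⟨p + q, fun ξ x => by simp [hp, hq], fun x => by simp [hfp, hgq]⟩
  algebraMap_mem' := fun r => ⟨MvPolynomial.C r, fun ξ x => by simp, fun x => by simp⟩

/-- The ring `A(𝔥)^H` of `H`-invariant real analytic functions on `𝔥*`, acting through restriction
to `Ω`. -/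
noncomputable def anaInv : Subalgebra ℝ Cas where
  carrier := {f | ∃ F : Dual → ℝ, AnalyticOnNhd ℝ F Set.univ ∧
    (∀ (ξ : 𝔥) (x : Dual), F (coAd ξ x) = F x) ∧ ∀ x : Ω, f.val x = F x}
  mul_mem' := by
    rintro f g ⟨F, hF, hF', hfF⟩ ⟨G, hG, hG', hgG⟩
    exact ⟨F * G, hF.mul hG, fun ξ x => by simp [hF', hG'], fun x => by simp [hfF, hgG]⟩
  add_mem' := by
    rintro f g ⟨F, hF, hF', hfF⟩ ⟨G, hG, hG', hgG⟩
    exact ⟨F + G, hF.add hG, fun ξ x => by simp [hF', hG'], fun x => by simp [hfF, hgG]⟩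
  algebraMap_mem' := fun r => ⟨fun _ => r, analyticOnNhd_const, fun _ _ => rfl, fun _ => rfl⟩

/-! ### Multivector fields and the Poisson coboundary -/

/-- `⋀^k T_x𝔥*`: the alternating `k`-linear forms on the cotangent space `𝔥`. -/
abbrev Fiber (k : ℕ) : Type := 𝔥 [⋀^Fin k]→L[ℝ] ℝ

/-- The smooth `k`-vector fields on `Ω`. They form the `I(Ω)`-module `V^k(Ω)`. -/
@[ext] structure V (k : ℕ) where
  /-- the underlying section -/
  val : Ω → Fiber k
  smooth : Smooth val

namespace V

variable {k : ℕ}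

noncomputable instance : Zero (V k) := ⟨⟨fun _ => 0, Smooth.const 0⟩⟩

noncomputable instance : Add (V k) := ⟨fun P Q => ⟨P.val + Q.val, P.smooth.add Q.smooth⟩⟩

noncomputable instance : Neg (V k) := ⟨fun P => ⟨-P.val, P.smooth.neg⟩⟩

noncomputable instance : SMul Cas (V k) := ⟨fun f P => ⟨f.val • P.val, f.smooth.smul P.smooth⟩⟩

@[simp] theorem zero_val (x : Ω) : (0 : V k).val x = 0 := rfl

@[simp] theorem add_val (P Q : V k) (x : Ω) : (P + Q).val x = P.val x + Q.val x := rfl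

@[simp] theorem neg_val (P : V k) (x : Ω) : (-P).val x = -P.val x := rfl

@[simp] theorem smul_val (f : Cas) (P : V k) (x : Ω) : (f • P).val x = f.val x • P.val x := rfl

theorem ext_val {P Q : V k} (h : ∀ x, P.val x = Q.val x) : P = Q := V.ext (funext h)

noncomputable instance : AddCommGroup (V k) where
  add_assoc P Q R := ext_val fun x => by simp [add_assoc]
  zero_add P := ext_val fun x => by simp
  add_zero P := ext_val fun x => by simp
  add_comm P Q := ext_val fun x => by simp [add_comm]
  neg_add_cancel P := ext_val fun x => by simp
  nsmul := nsmulRec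
  zsmul := zsmulRec

noncomputable instance : Module Cas (V k) where
  one_smul P := ext_val fun x => by simp
  mul_smul f g P := ext_val fun x => by simp [mul_smul]
  smul_zero f := ext_val fun x => by simp
  smul_add f P Q := ext_val fun x => by simp
  add_smul f g P := ext_val fun x => by simp [add_smul]
  zero_smul P := ext_val fun x => by simp

end V

/-- The part of the coboundary that does not differentiate `Q`:
`(v₀, …, v_k) ↦ ∑_{i<j} (-1)^{i+j} Q([v_i, v_j], v₀, …, v̂_i, …, v̂_j, …, v_k)`. -/
noncomputable def bracketTerm : (k : ℕ) → Fiber k →L[ℝ] Fiber (k + 1)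
  | 0 => 0
  | (m + 1) =>
    let c : Fiber (m + 1) →L[ℝ] 𝔥 →L[ℝ] Fiber m :=
      ContinuousAlternatingMap.curryLeftLI.toContinuousLinearMap
    let p : (𝔥 →L[ℝ] Fiber m) →L[ℝ] 𝔥 →L[ℝ] 𝔥 →L[ℝ] Fiber m :=
      (ContinuousLinearMap.compL ℝ 𝔥 (𝔥 →L[ℝ] 𝔥) (𝔥 →L[ℝ] Fiber m)).flip lieCLM ∘L
        ContinuousLinearMap.compL ℝ 𝔥 𝔥 (Fiber m)
    let a : (𝔥 →L[ℝ] 𝔥 →L[ℝ] Fiber m) →L[ℝ] Fiber (m + 2) :=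
      ContinuousAlternatingMap.alternatizeUncurryFinCLM ℝ 𝔥 ℝ ∘L
        ContinuousLinearMap.compL ℝ 𝔥 (𝔥 →L[ℝ] Fiber m) (Fiber (m + 1))
          (ContinuousAlternatingMap.alternatizeUncurryFinCLM ℝ 𝔥 ℝ)
    (-(1 / 2 : ℝ)) • (a ∘L p ∘L c)

theorem bracketTerm_zero : bracketTerm 0 = 0 := rfl

/-- Pairs `i < j` of indices in `Fin (m + 2)` are written `(i.castSucc, j.succ)` with `i ≤ j` in
`Fin (m + 1)`, whence the sign. -/
theorem bracketTerm_succ (m : ℕ) (Q : Fiber (m + 1)) (v : Fin (m + 2) → 𝔥) :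
    bracketTerm (m + 1) Q v =
      -∑ i : Fin (m + 1), ∑ j ≥ i, (-1 : ℝ) ^ (i + j : ℕ) *
        Q (Matrix.vecCons ⁅v i.castSucc, v j.succ⁆ (j.removeNth (i.castSucc.removeNth v))) := by
  have h (a b : 𝔥) (w : Fin m → 𝔥) :
      Q (Matrix.vecCons ⁅a, b⁆ w) = -Q (Matrix.vecCons ⁅b, a⁆ w) := by
    have := congrArg (fun f => f w) (map_neg Q.curryLeft ⁅b, a⁆)
    simp only [ContinuousAlternatingMap.neg_apply, lie_skew,
      ContinuousAlternatingMap.curryLeft_apply_apply] at this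
    exact this
  have e : bracketTerm (m + 1) Q = -(1 / 2 : ℝ) • ContinuousAlternatingMap.alternatizeUncurryFin
        (ContinuousAlternatingMap.alternatizeUncurryFinCLM ℝ 𝔥 ℝ ∘L
          (ContinuousLinearMap.compL ℝ 𝔥 𝔥 (Fiber m) Q.curryLeft ∘L lieCLM)) := rfl
  rw [e, ContinuousAlternatingMap.smul_apply,
    ContinuousAlternatingMap.alternatizeUncurryFin_alternatizeUncurryFinCLM_comp_apply,
    Finset.smul_sum, ← Finset.sum_neg_distrib]
  refine Finset.sum_congr rfl fun i _ => ?_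
  rw [Finset.smul_sum, ← Finset.sum_neg_distrib]
  refine Finset.sum_congr rfl fun j _ => ?_
  simp
  rw [h (v j.succ)]
  ring

/-- The value at `x` of the Poisson coboundary `σ Q = [Λ, Q]`, through the Koszul formula
`σQ(α₀, …, α_k) = ∑ (-1)^i α_i^#(Q(α₀, …, α̂_i, …, α_k))
  + ∑_{i<j} (-1)^{i+j} Q({α_i, α_j}, α₀, …, α̂_i, …, α̂_j, …, α_k)`.
Both sides are tensorial in the one-forms, so it is enough to take them constant, and for the
constant one-forms `ξ, η ∈ 𝔥` one has `{ξ, η} = d(Λ(ξ, η)) = [ξ, η]`.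
See `sigmaAt_zero` and `sigmaAt_succ` for the resulting expressions. -/
noncomputable def sigmaAt (k : ℕ) (Q : Ω → Fiber k) (x : Ω) : Fiber (k + 1) :=
  ContinuousAlternatingMap.alternatizeUncurryFin (D Q x ∘L sharp x) + bracketTerm k (Q x)

theorem sigmaAt_zero (Q : Ω → Fiber 0) (x : Ω) (v : Fin 1 → 𝔥) :
    sigmaAt 0 Q x v = D Q x (sharp x (v 0)) ![] := by
  simp only [sigmaAt, bracketTerm_zero, ContinuousAlternatingMap.alternatizeUncurryFin_apply,
    zero_apply, add_zero]
  have h : Fin.removeNth 0 v = ![] := Subsingleton.elim _ _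
  simp [h]

theorem sigmaAt_succ (k : ℕ) (Q : Ω → Fiber (k + 1)) (x : Ω) (v : Fin (k + 2) → 𝔥) :
    sigmaAt (k + 1) Q x v =
      ∑ i : Fin (k + 2), (-1 : ℝ) ^ (i : ℕ) * D Q x (sharp x (v i)) (i.removeNth v) -
      ∑ i : Fin (k + 1), ∑ j ≥ i, (-1 : ℝ) ^ (i + j : ℕ) *
        Q x (Matrix.vecCons ⁅v i.castSucc, v j.succ⁆ (j.removeNth (i.castSucc.removeNth v))) := by
  rw [sigmaAt, ContinuousAlternatingMap.add_apply, bracketTerm_succ,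
    ContinuousAlternatingMap.alternatizeUncurryFin_apply, ← sub_eq_add_neg]
  simp

theorem sigmaAt_smooth (k : ℕ) {Q : Ω → Fiber k} (hQ : Smooth Q) : Smooth (sigmaAt k Q) := by
  refine Smooth.congr (F := fun x =>
    ContinuousAlternatingMap.alternatizeUncurryFinCLM ℝ 𝔥 ℝ (ext0 (D Q) x ∘L sharp x) +
      bracketTerm k (ext0 Q x)) ?_ fun x => by simp [sigmaAt]
  refine ContDiffOn.add ?_ ?_
  · exact (ContinuousLinearMap.contDiff _).comp_contDiffOn
      (ContDiffOn.clm_comp hQ.D sharp_smooth.contDiffOn)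
  · exact (bracketTerm k).contDiff.comp_contDiffOn hQ

/-- The Poisson coboundary operator `σ : V^k(Ω) → V^{k+1}(Ω)`; it is linear over the Casimirs. -/
noncomputable def sigma (k : ℕ) : V k →ₗ[Cas] V (k + 1) where
  toFun Q := ⟨sigmaAt k Q.val, sigmaAt_smooth k Q.smooth⟩
  map_add' P Q := V.ext_val fun x => by
    change sigmaAt k (P.val + Q.val) x = sigmaAt k P.val x + sigmaAt k Q.val x
    simp only [sigmaAt, D_add P.smooth Q.smooth, ContinuousLinearMap.add_comp, Pi.add_apply,
      map_add, ContinuousAlternatingMap.alternatizeUncurryFin_add]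
    abel
  map_smul' f Q := V.ext_val fun x => by
    change sigmaAt k (f.val • Q.val) x = f.val x • sigmaAt k Q.val x
    have h : (D f.val x).smulRight (Q.val x) ∘L sharp x = 0 := by
      ext1 ξ
      simp [f.casimir x ξ]
    simp only [sigmaAt, D_smul f.smooth Q.smooth, ContinuousLinearMap.add_comp, h, add_zero,
      ContinuousLinearMap.smul_comp, Pi.smul_apply', map_smul, smul_add,
      ContinuousAlternatingMap.alternatizeUncurryFin_smul]

@[simp] theorem sigma_val (k : ℕ) (Q : V k) : (sigma k Q).val = sigmaAt k Q.val := rfl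

/-! ### Poisson cohomology and tangential Poisson cohomology -/

/-- Poisson `k`-cocycles. -/
noncomputable def cocycles (k : ℕ) : Submodule Cas (V k) := LinearMap.ker (sigma k)

/-- Poisson `k`-coboundaries. -/
noncomputable def coboundaries : (k : ℕ) → Submodule Cas (V k)
  | 0 => ⊥
  | (k + 1) => LinearMap.range (sigma k)

/-- The Poisson cohomology space `H^k_Λ(Ω) = ker σ / im σ`, a module over `I(Ω)`. -/
abbrev H (k : ℕ) : Type := cocycles k ⧸ (coboundaries k).submoduleOf (cocycles k)

/-- The class of a Poisson cocycle. -/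
noncomputable def H.mk {k : ℕ} (Q : cocycles k) : H k := Submodule.Quotient.mk Q

/-- The tangential `k`-vector fields, i.e. the sections of `⋀^k TF`, `F` the symplectic foliation.
As `T_xF` is the image of `#_x`, whose annihilator is the kernel of `#_x`, a `k`-vector at `x` lies
in `⋀^k T_xF` if and only if it vanishes as soon as one of its arguments lies in that kernel. -/
noncomputable def Vtan (k : ℕ) : Submodule Cas (V k) where
  carrier := {Q | ∀ (x : Ω) (v : Fin k → 𝔥), (∃ i, sharp x (v i) = 0) → Q.val x v = 0}
  add_mem' := by
    intro P Q hP hQ x v hv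
    simp [hP x v hv, hQ x v hv]
  zero_mem' := fun _ _ _ => by simp
  smul_mem' := fun f Q hQ x v hv => by simp [hQ x v hv]

/-- Tangential `k`-cocycles. -/
noncomputable def cocyclesTan (k : ℕ) : Submodule Cas (V k) := cocycles k ⊓ Vtan k

/-- Coboundaries of tangential multivector fields. -/
noncomputable def coboundariesTan : (k : ℕ) → Submodule Cas (V k)
  | 0 => ⊥
  | (k + 1) => (Vtan k).map (sigma k)

/-- The tangential Poisson cohomology space `H^k_{Λ,tan}(Ω)`, a module over `I(Ω)`: the cohomology
of the restriction of `σ` to tangential multivector fields. -/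
abbrev Htan (k : ℕ) : Type := cocyclesTan k ⧸ (coboundariesTan k).submoduleOf (cocyclesTan k)

/-- The class of a tangential cocycle. -/
noncomputable def Htan.mk {k : ℕ} (Q : cocyclesTan k) : Htan k := Submodule.Quotient.mk Q

/-- A tangential cocycle as a Poisson cocycle. -/
noncomputable def tanIncl (k : ℕ) : cocyclesTan k →ₗ[Cas] cocycles k :=
  Submodule.inclusion inf_le_left

/-- "Infinite dimensional": infinite dimensional as a real vector space, and finitely generated
neither over `S(𝔥)^H` nor over `A(𝔥)^H`. -/
def IsInfDim (M : Type) [AddCommGroup M] [Module Cas M] : Prop :=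
  ¬ Module.Finite ℝ (RestrictScalars ℝ Cas M) ∧ ¬ Module.Finite polyInv M ∧ ¬ Module.Finite anaInv M

/-! ### The transverse vector field -/

/-- The value at `x` of the one-form `β = x₂ dx₃ + x₃ dx₂`. -/
noncomputable def beta (x : Dual) : 𝔥 := x 1 • X 2 + x 2 • X 1

/-- The constant vector field `∂_i`. -/
noncomputable def del (i : Fin 3) : Fiber 1 :=
  ContinuousAlternatingMap.ofSubsingleton ℝ 𝔥 ℝ (0 : Fin 1)
    (LinearMap.toContinuousLinearMap
      { toFun := fun ξ => ξ i
        map_add' := fun _ _ => rfl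
        map_smul' := fun _ _ => rfl })

/-- The value at `x` of the vector field `(x₂ ∂₃ + x₃ ∂₂) / (x₂² + x₃²)`. -/
noncomputable def transvAt (x : Dual) : Fiber 1 :=
  (x 1 ^ 2 + x 2 ^ 2)⁻¹ • (x 1 • del 2 + x 2 • del 1)

theorem transvAt_smooth : ContDiffOn ℝ ∞ transvAt Ω := by
  refine ContDiffOn.smul (ContDiffOn.inv (by fun_prop) fun x hx => hx) (by fun_prop)

/-- The vector field `(x₂ ∂₃ + x₃ ∂₂) / (x₂² + x₃²)` on `Ω`, transverse to the symplectic
foliation. -/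
noncomputable def transv : V 1 := ⟨fun x => transvAt x, Smooth.congr transvAt_smooth fun _ => rfl⟩

/-! ### A parametrization of the quadrant `x₂, x₃ > 0` -/

/-- The inverse of `(x₂, x₃) ↦ (x₂ x₃, (x₂² - x₃²) / 2)` on the quadrant `x₂, x₃ > 0`, where
`u > 0`. -/
noncomputable def phi (u v : ℝ) : ℝ × ℝ :=
  if 0 < v then (√(v + √(u ^ 2 + v ^ 2)), u / √(v + √(u ^ 2 + v ^ 2)))
  else if v < 0 then (u / √(-v + √(u ^ 2 + v ^ 2)), √(-v + √(u ^ 2 + v ^ 2)))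
  else (√u, √u)

end LiePoissonH

namespace LiePoissonH

/-! At each point of Ω the kernel of `sharp` is the line spanned by the one-form β, and β is
invariant under the Hamiltonian fields of constant covectors (`beta_sharp`). Hence contraction with
β anticommutes with σ in the degrees needed (`contr_sigma_one`, `contr_sigma_two`), its kernel is
exactly the tangential fields (`mem_Vtan_succ`), and its values are annihilated by a second
contraction. Together with lifting by the transverse field X, for which β(X) = 1, this expresses the
Poisson complex through two copies of the tangential one, the second shifted by a degree.

The leaves are surfaces, so tangential fields vanish from degree 3 on. In degree 2 every tangential
field is σ(a∂₁) with a tangential primitive: only ∂₁a matters, and one can integrate in x₁ because Ω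
is a product with the x₁-line (`exists_primitive`, `exists_sigma_eq_of_mem_Vtan_two`). Only
tangential degrees 0 and 1 survive. In degree 1, X has a tangential correction N that is a cocycle,
and Q ↦ Q - β(Q)N splits off the tangential part; in degree 2, contraction induces the isomorphism
with tangential degree 1.

Infinite dimensionality comes from the singular level x₂x₃ = 0, where leaf arcs become infinitely
long. The ∂₁-component of a tangential cocycle is integrated along the orbit of H_{x₁} from (0,
e^{2s}, 1) to (0, 1, e^{2s}). For a coboundary this is a difference of endpoint values, bounded as s
→ -∞ since both endpoints converge inside Ω. Casimirs are constant on the arc and bounded in the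
same limit. Finitely many generators would thus bound the growth of the integrals of all cocycles,
yet K(log(x₂²+x₃²))∂₁ is a cocycle whose integral grows as fast as desired (`not_finite_Htan_one`).
The necessary condition for H_{x₁}g = a uses the same arcs, parametrized by v = (x₂²-x₃²)/2. -/

/-! ### Smooth dependence of integrals on a parameter. -/

open MeasureTheory in
theorem hasFDerivAt_integral_of_contDiffOn {E F : Type} [NormedAddCommGroup E] [NormedSpace ℝ E]
    [ProperSpace E] [NormedAddCommGroup F] [NormedSpace ℝ F] [CompleteSpace F] {U : Set E}
    (hU : IsOpen U) {f : E × ℝ → F} (hf : ContDiffOn ℝ 1 f (U ×ˢ Set.univ)) {x : E}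
    (hx : x ∈ U) :
    HasFDerivAt (fun x => ∫ s in (0 : ℝ)..1, f (x, s))
      (∫ s in (0 : ℝ)..1, fderiv ℝ f (x, s) ∘L ContinuousLinearMap.inl ℝ E ℝ) x := by
  have hO : IsOpen (U ×ˢ (Set.univ : Set ℝ)) := hU.prod isOpen_univ
  have hc : ContinuousOn (fun q => fderiv ℝ f q ∘L ContinuousLinearMap.inl ℝ E ℝ)
      (U ×ˢ Set.univ) :=
    (hf.continuousOn_fderiv_of_isOpen hO le_rfl).clm_comp continuousOn_const
  -- The dominating function is a constant: the derivative is continuous, hence bounded on the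
  -- compact product of a small closed ball with [0, 1].
  obtain ⟨ε, hε, hεU⟩ := Metric.nhds_basis_closedBall.mem_iff.1 (hU.mem_nhds hx)
  obtain ⟨C, hC⟩ := ((isCompact_closedBall x ε).prod (isCompact_Icc (a := (0 : ℝ)) (b := 1))
    ).exists_bound_of_continuousOn (hc.mono fun q hq => ⟨hεU hq.1, trivial⟩)
  have hsl : ∀ y ∈ U, Continuous fun s : ℝ => f (y, s) := fun y hy =>
    hf.continuousOn.comp_continuous (by fun_prop) fun s => ⟨hy, trivial⟩
  have hIoc : Set.uIoc (0 : ℝ) 1 ⊆ Set.Icc 0 1 := by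
    rw [Set.uIoc_of_le zero_le_one]; exact Set.Ioc_subset_Icc_self
  refine (intervalIntegral.hasFDerivAt_integral_of_dominated_of_fderiv_le
    (F := fun x s => f (x, s)) (μ := volume) (bound := fun _ => C)
    (F' := fun x s => fderiv ℝ f (x, s) ∘L ContinuousLinearMap.inl ℝ E ℝ)
    (Metric.closedBall_mem_nhds x hε) ?_ ?_ ?_ ?_ ?_ ?_)
  · filter_upwards [hU.mem_nhds hx] with y hy using (hsl y hy).aestronglyMeasurable
  · exact (hsl x hx).intervalIntegrable _ _
  · exact (hc.comp_continuous (f := fun s : ℝ => (x, s)) (by fun_prop)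
      fun s => ⟨hx, trivial⟩).aestronglyMeasurable
  · exact .of_forall fun s hs y hy => hC (y, s) ⟨hy, hIoc hs⟩
  · exact intervalIntegrable_const
  · refine .of_forall fun s _ y hy => ?_
    have h1 : HasFDerivAt f (fderiv ℝ f (y, s)) (y, s) :=
      ((hf.contDiffAt (hO.mem_nhds ⟨hεU hy, trivial⟩)).differentiableAt (by simp)).hasFDerivAt
    exact h1.comp y (hasFDerivAt_prodMk_left y s)

/-- Induction on the order by differentiating under the integral sign. One spare derivative supplies
the domination at order 0, and costs nothing for smooth integrands. The target `F` is quantified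
inside the induction because the integrand becomes operator-valued at each step. -/
theorem contDiffOn_nat_integral {E : Type} [NormedAddCommGroup E] [NormedSpace ℝ E]
    [ProperSpace E] {U : Set E} (hU : IsOpen U) (n : ℕ) :
    ∀ {F : Type} [NormedAddCommGroup F] [NormedSpace ℝ F] [CompleteSpace F] {f : E × ℝ → F},
      ContDiffOn ℝ (n + 1 : ℕ) f (U ×ˢ Set.univ) →
      ContDiffOn ℝ n (fun x => ∫ s in (0 : ℝ)..1, f (x, s)) U := by
  induction n with
  | zero =>
    intro F _ _ _ f hf
    rw [Nat.cast_zero, contDiffOn_zero]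
    exact fun x hx => (hasFDerivAt_integral_of_contDiffOn hU (by simpa using hf)
      hx).continuousAt.continuousWithinAt
  | succ n ih =>
    intro F _ _ _ f hf
    have hO : IsOpen (U ×ˢ (Set.univ : Set ℝ)) := hU.prod isOpen_univ
    have hf1 : ContDiffOn ℝ 1 f (U ×ˢ Set.univ) := hf.of_le (by
      exact_mod_cast Nat.le_add_left 1 (n + 1))
    rw [Nat.cast_add, Nat.cast_one, contDiffOn_succ_iff_hasFDerivWithinAt_of_uniqueDiffOn
      hU.uniqueDiffOn]
    refine ⟨by simp, fun x => ∫ s in (0 : ℝ)..1,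
      fderiv ℝ f (x, s) ∘L ContinuousLinearMap.inl ℝ E ℝ, ?_, fun x hx =>
      (hasFDerivAt_integral_of_contDiffOn hU hf1 hx).hasFDerivWithinAt⟩
    refine ih (f := fun q => fderiv ℝ f q ∘L ContinuousLinearMap.inl ℝ E ℝ) ?_
    exact (hf.fderiv_of_isOpen hO (by norm_cast)).clm_comp contDiffOn_const

theorem contDiffOn_integral {E : Type} [NormedAddCommGroup E] [NormedSpace ℝ E]
    [ProperSpace E] {U : Set E} (hU : IsOpen U) {F : Type} [NormedAddCommGroup F]
    [NormedSpace ℝ F] [CompleteSpace F] {f : E × ℝ → F}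
    (hf : ContDiffOn ℝ ∞ f (U ×ˢ Set.univ)) :
    ContDiffOn ℝ ∞ (fun x => ∫ s in (0 : ℝ)..1, f (x, s)) U :=
  contDiffOn_infty.2 fun n => contDiffOn_nat_integral hU n (contDiffOn_infty.1 hf _)

/-! ### Curves in Ω and primitives along x₁. -/

/-- The point of `𝔥*` with the given coordinates. -/
def pt (p y z : ℝ) : Dual := ![p, y, z]

theorem pt_mem_Ω {p y z : ℝ} : pt p y z ∈ Ω ↔ y ^ 2 + z ^ 2 ≠ 0 := by simp [pt, Ω]

/-- The derivative of a function on `Ω` along a curve. -/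
theorem hasDerivAt_comp_curve {W : Type*} [NormedAddCommGroup W] [NormedSpace ℝ W] {Q : Ω → W}
    (hQ : Smooth Q) {c : ℝ → Dual} {c' : Dual} {t : ℝ} (hc : HasDerivAt c c' t)
    (ht : c t ∈ Ω) : HasDerivAt (fun s => ext0 Q (c s)) (D Q ⟨c t, ht⟩ c') t :=
  (hQ.diffAt ⟨c t, ht⟩).hasFDerivAt.comp_hasDerivAt t hc

/-- The constant vector `∂₁`. -/
def e₀ : Dual := pt 1 0 0

/-- Every smooth function on `Ω` has a smooth primitive in the direction of `x₁`. -/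
theorem exists_primitive {f : Ω → ℝ} (hf : Smooth f) :
    ∃ F : Ω → ℝ, Smooth F ∧ ∀ x, D F x e₀ = f x := by
  -- This is the integral of f from 0 to x₁, rescaled to a fixed interval so that only the integrand
  -- depends on the parameter. The segment stays in Ω since membership does not involve x₁.
  let G : Dual → ℝ := fun x => x 0 * ∫ s in (0 : ℝ)..1, ext0 f (pt (s * x 0) (x 1) (x 2))
  have hG : ContDiffOn ℝ ∞ G Ω := by
    refine ContDiffOn.mul (by fun_prop) (contDiffOn_integral isOpen_Ω
      (f := fun q : Dual × ℝ => ext0 f (pt (q.2 * q.1 0) (q.1 1) (q.1 2))) ?_)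
    refine ContDiffOn.comp hf (ContDiff.contDiffOn ?_) fun q hq => pt_mem_Ω.2 hq.1
    refine contDiff_pi.2 fun i => ?_
    fin_cases i <;> simp [pt] <;> fun_prop
  have hS : Smooth (fun x : Ω => G x) := Smooth.congr hG fun _ => rfl
  refine ⟨_, hS, fun x => ?_⟩
  have hmem : ∀ s, pt s (x.1 1) (x.1 2) ∈ Ω := fun s => pt_mem_Ω.2 x.2
  have hx : pt (x.1 0) (x.1 1) (x.1 2) = x := by ext i; fin_cases i <;> rfl
  have hcurve : ∀ s : ℝ, HasDerivAt (fun s => pt s (x.1 1) (x.1 2)) e₀ s := fun s => by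
    refine hasDerivAt_pi.2 fun i => ?_
    fin_cases i <;> simp [pt, e₀, hasDerivAt_id', hasDerivAt_const]
  have hcont : Continuous fun s => ext0 f (pt s (x.1 1) (x.1 2)) :=
    continuous_iff_continuousAt.2 fun s => (hasDerivAt_comp_curve hf (hcurve s) (hmem s)).continuousAt
  have h1 := hasDerivAt_comp_curve hS (hcurve (x.1 0)) (hmem _)
  have h2 : HasDerivAt (fun s => ext0 (fun x : Ω => G x) (pt s (x.1 1) (x.1 2)))
      (ext0 f (pt (x.1 0) (x.1 1) (x.1 2))) (x.1 0) := by
    have : (fun s => ext0 (fun x : Ω => G x) (pt s (x.1 1) (x.1 2))) =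
        fun s => ∫ r in (0 : ℝ)..s, ext0 f (pt r (x.1 1) (x.1 2)) := by
      funext s
      rw [ext0_coe (fun x : Ω => G x) ⟨_, hmem s⟩]
      have := intervalIntegral.smul_integral_comp_mul_right (a := 0) (b := 1)
        (fun r => ext0 f (pt r (x.1 1) (x.1 2))) s
      simpa [G, pt] using this
    rw [this]
    exact hcont.integral_hasStrictDerivAt 0 _ |>.hasDerivAt
  have h3 := h1.unique h2
  have hx' : (⟨_, hmem (x.1 0)⟩ : Ω) = x := Subtype.ext hx
  rwa [hx', hx, ext0_coe] at h3

/-! ### Alternating forms on `𝔥` -/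

/-- The basis `X₁, X₂, X₃` of `𝔥`. -/
noncomputable def stdBasis : Module.Basis (Fin 3) ℝ 𝔥 := Pi.basisFun ℝ (Fin 3)

theorem stdBasis_apply (i : Fin 3) : stdBasis i = X i := by
  ext j
  change (Pi.basisFun ℝ (Fin 3) i) j = _
  simp [X, Pi.single_apply]

theorem Fiber.ext_basis {k : ℕ} {f g : Fiber k}
    (h : ∀ v : Fin k → Fin 3, Function.Injective v →
      f (fun i => X (v i)) = g (fun i => X (v i))) : f = g := by
  apply ContinuousAlternatingMap.toAlternatingMap_injective
  refine stdBasis.ext_alternating fun v hv => ?_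
  simpa [stdBasis_apply] using h v hv

theorem Fiber.eq_of_four_le {k : ℕ} (hk : 4 ≤ k) (f g : Fiber k) : f = g :=
  Fiber.ext_basis fun v hv => by
    have := Fintype.card_le_of_injective v hv
    simp at this
    omega

theorem Fiber.ext_three {f g : Fiber 3} (h : f ![X 0, X 1, X 2] = g ![X 0, X 1, X 2]) :
    f = g := by
  refine Fiber.ext_basis fun v hv => ?_
  have hX : X = ![X 0, X 1, X 2] := by funext i; fin_cases i <;> rfl
  have e (f : Fiber 3) := f.toAlternatingMap.map_perm X
    (Equiv.ofBijective v (Finite.injective_iff_bijective.1 hv))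
  have ef := e f
  have eg := e g
  rw [hX] at ef eg
  have hv' : (fun i => X (v i)) = ![X 0, X 1, X 2] ∘
      (Equiv.ofBijective v (Finite.injective_iff_bijective.1 hv)) := by
    rw [← hX]; rfl
  rw [hv']
  exact ef.trans ((congrArg _ h).trans eg.symm)

theorem Fiber.swap_two (f : Fiber 2) (a b : 𝔥) : f ![a, b] = -f ![b, a] := by
  have := f.toAlternatingMap.map_swap ![b, a] (i := 0) (j := 1) (by decide)
  have h : ![b, a] ∘ (Equiv.swap 0 1 : Equiv.Perm (Fin 2)) = ![a, b] := by
    funext i; fin_cases i <;> simp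
  rw [h] at this
  exact this

theorem Fiber.ext_two {f g : Fiber 2} (h01 : f ![X 0, X 1] = g ![X 0, X 1])
    (h02 : f ![X 0, X 2] = g ![X 0, X 2]) (h12 : f ![X 1, X 2] = g ![X 1, X 2]) : f = g := by
  refine Fiber.ext_basis fun v hv => ?_
  have e : (fun i => X (v i)) = ![X (v 0), X (v 1)] := by funext i; fin_cases i <;> rfl
  have hne : v 0 ≠ v 1 := fun h => by simpa using hv h
  rw [e]
  generalize v 0 = i at *
  generalize v 1 = j at *
  have s01 := (f.swap_two (X 1) (X 0)).trans ((congrArg _ h01).trans (g.swap_two _ _).symm)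
  have s02 := (f.swap_two (X 2) (X 0)).trans ((congrArg _ h02).trans (g.swap_two _ _).symm)
  have s12 := (f.swap_two (X 2) (X 1)).trans ((congrArg _ h12).trans (g.swap_two _ _).symm)
  fin_cases i <;> fin_cases j <;> first | exact absurd rfl hne | assumption

theorem Fiber.add_head {k : ℕ} (f : Fiber (k + 1)) (a b : 𝔥) (v : Fin k → 𝔥) :
    f (Matrix.vecCons (a + b) v) = f (Matrix.vecCons a v) + f (Matrix.vecCons b v) :=
  f.toAlternatingMap.toMultilinearMap.cons_add v a b

theorem Fiber.smul_head {k : ℕ} (f : Fiber (k + 1)) (c : ℝ) (a : 𝔥) (v : Fin k → 𝔥) :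
    f (Matrix.vecCons (c • a) v) = c * f (Matrix.vecCons a v) :=
  f.toAlternatingMap.toMultilinearMap.cons_smul v c a

theorem Fiber.neg_head {k : ℕ} (f : Fiber (k + 1)) (a : 𝔥) (v : Fin k → 𝔥) :
    f (Matrix.vecCons (-a) v) = -f (Matrix.vecCons a v) := by
  rw [← neg_one_smul ℝ a, f.smul_head]; ring

theorem 𝔥.eq_sum (ξ : 𝔥) : ξ = ξ 0 • X 0 + (ξ 1 • X 1 + ξ 2 • X 2) := by
  ext i; fin_cases i <;> simp [X]

theorem Fiber.one_apply (f : Fiber 1) (ξ : 𝔥) :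
    f ![ξ] = ξ 0 * f ![X 0] + (ξ 1 * f ![X 1] + ξ 2 * f ![X 2]) := by
  conv_lhs => rw [ξ.eq_sum]
  rw [f.add_head, f.add_head, f.smul_head, f.smul_head, f.smul_head]

theorem Fiber.ext_one {f g : Fiber 1} (h : ∀ ξ, f ![ξ] = g ![ξ]) : f = g :=
  ContinuousAlternatingMap.ext fun v => by
    rw [show v = ![v 0] by funext i; fin_cases i; rfl, h]

@[simp] theorem del_apply (i : Fin 3) (v : Fin 1 → 𝔥) : del i v = v 0 i := rfl

/-- The `i`-th coordinate on `𝔥`. -/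
noncomputable def coordCLM (i : Fin 3) : 𝔥 →L[ℝ] ℝ :=
  LinearMap.toContinuousLinearMap
    { toFun := fun ξ => ξ i
      map_add' := fun _ _ => rfl
      map_smul' := fun _ _ => rfl }

@[simp] theorem coordCLM_apply (i : Fin 3) (ξ : 𝔥) : coordCLM i ξ = ξ i := rfl

/-- The constant bivector field `∂_i ∧ ∂_j`. -/
noncomputable def del₂ (i j : Fin 3) : Fiber 2 :=
  ContinuousAlternatingMap.alternatizeUncurryFin
    ((coordCLM i).smulRight (del j))

@[simp] theorem del₂_apply (i j : Fin 3) (a b : 𝔥) : del₂ i j ![a, b] = a i * b j - b i * a j := by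
  rw [del₂, ContinuousAlternatingMap.alternatizeUncurryFin_apply]
  simp [Fin.sum_univ_two, Fin.removeNth]
  ring

/-! ### The map `#` and the one-form `β` -/

theorem sharp_eq (x : Dual) (ξ : 𝔥) :
    sharp x ξ = pt (-(ξ 1 * x 1) + ξ 2 * x 2) (ξ 0 * x 1) (-(ξ 0 * x 2)) := by
  ext i
  rw [sharp_apply]
  fin_cases i <;> simp [Λ, pairing, Fin.sum_univ_three, X, pt] <;> ring

@[simp] theorem beta_zero (x : Dual) : beta x 0 = 0 := by simp [beta, X]
@[simp] theorem beta_one (x : Dual) : beta x 1 = x 2 := by simp [beta, X]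
@[simp] theorem beta_two (x : Dual) : beta x 2 = x 1 := by simp [beta, X]

@[simp] theorem sharp_beta (x : Dual) : sharp x (beta x) = 0 := by
  rw [sharp_eq]; ext i; fin_cases i <;> simp [pt]; ring

/-- The last two components of ξ^# force ξ₁ = 0, and the first makes (ξ₂, ξ₃) parallel to (x₃, x₂).
The factor is the orthogonal projection coefficient ⟨ξ, β⟩/|β|². -/
theorem exists_smul_beta {x : Dual} (hx : x ∈ Ω) {ξ : 𝔥} (h : sharp x ξ = 0) :
    ∃ c : ℝ, ξ = c • beta x := by
  have hx : x 1 ^ 2 + x 2 ^ 2 ≠ 0 := hx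
  rw [sharp_eq] at h
  have h0 : -(ξ 1 * x 1) + ξ 2 * x 2 = 0 := congrFun h 0
  have h1 : ξ 0 * x 1 = 0 := congrFun h 1
  have h2 : -(ξ 0 * x 2) = 0 := congrFun h 2
  have h3 : ξ 0 * (x 1 ^ 2 + x 2 ^ 2) = 0 := by linear_combination x 1 * h1 - x 2 * h2
  refine ⟨(ξ 1 * x 2 + ξ 2 * x 1) / (x 1 ^ 2 + x 2 ^ 2), ?_⟩
  ext i
  fin_cases i <;> simp
  · simpa [hx] using h3
  · field_simp; linear_combination -x 1 * h0
  · field_simp; linear_combination x 2 * h0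

/-- `x ↦ β_x` is linear. -/
noncomputable def betaCLM : Dual →L[ℝ] 𝔥 :=
  LinearMap.toContinuousLinearMap
    { toFun := beta
      map_add' := fun a b => by ext i; fin_cases i <;> simp
      map_smul' := fun c a => by ext i; fin_cases i <;> simp }

@[simp] theorem betaCLM_apply (x : Dual) : betaCLM x = beta x := rfl

/-- The one-form `β` is invariant under Hamiltonian vector fields. -/
theorem beta_sharp (x : Dual) (ξ : 𝔥) : beta (sharp x ξ) = -⁅ξ, beta x⁆ := by
  rw [sharp_eq]; ext i; fin_cases i <;> simp [pt]

/-! ### Derivatives of sections -/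

theorem Smooth.clm {W W' : Type*} [NormedAddCommGroup W] [NormedSpace ℝ W] [NormedAddCommGroup W']
    [NormedSpace ℝ W'] {Q : Ω → W} (hQ : Smooth Q) (L : W →L[ℝ] W') : Smooth fun x => L (Q x) :=
  Smooth.congr (L.contDiff.comp_contDiffOn hQ) fun x => by simp

theorem D_clm {W W' : Type*} [NormedAddCommGroup W] [NormedSpace ℝ W] [NormedAddCommGroup W']
    [NormedSpace ℝ W'] {Q : Ω → W} (hQ : Smooth Q) (L : W →L[ℝ] W') (x : Ω) (v : Dual) :
    D (fun x => L (Q x)) x v = L (D Q x v) := by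
  rw [D_eq (F := L ∘ ext0 Q) (fun x => by simp), fderiv_comp _ L.differentiableAt (hQ.diffAt x)]
  simp [D]

theorem Smooth.of_contDiff {W : Type*} [NormedAddCommGroup W] [NormedSpace ℝ W] {F : Dual → W}
    (hF : ContDiff ℝ ∞ F) : Smooth fun x : Ω => F x :=
  Smooth.congr hF.contDiffOn fun _ => rfl

theorem Smooth.clm_apply {W W' : Type*} [NormedAddCommGroup W] [NormedSpace ℝ W]
    [NormedAddCommGroup W'] [NormedSpace ℝ W'] {L : Ω → W →L[ℝ] W'} {Q : Ω → W}
    (hL : Smooth L) (hQ : Smooth Q) : Smooth fun x => L x (Q x) :=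
  Smooth.congr (ContDiffOn.clm_apply hL hQ) fun x => by simp

theorem D_clm_apply {W W' : Type*} [NormedAddCommGroup W] [NormedSpace ℝ W]
    [NormedAddCommGroup W'] [NormedSpace ℝ W'] {L : Ω → W →L[ℝ] W'} {Q : Ω → W}
    (hL : Smooth L) (hQ : Smooth Q) (x : Ω) (v : Dual) :
    D (fun x => L x (Q x)) x v = L x (D Q x v) + D L x v (Q x) := by
  rw [D_eq (F := fun x => ext0 L x (ext0 Q x)) (fun x => by simp),
    fderiv_clm_apply (hL.diffAt x) (hQ.diffAt x)]
  simp [D]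

theorem D_clm_coe (L : Dual →L[ℝ] 𝔥) (x : Ω) : D (fun x : Ω => L x) x = L := by
  rw [D_eq (F := L) (fun _ => rfl), L.fderiv]

/-- Evaluation of alternating forms. -/
noncomputable def evalCLM {k : ℕ} (v : Fin k → 𝔥) : Fiber k →L[ℝ] ℝ :=
  ContinuousAlternatingMap.apply ℝ 𝔥 ℝ v

@[simp] theorem evalCLM_apply {k : ℕ} (v : Fin k → 𝔥) (f : Fiber k) : evalCLM v f = f v := rfl

theorem Smooth.eval {k : ℕ} {Q : Ω → Fiber k} (hQ : Smooth Q) (v : Fin k → 𝔥) :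
    Smooth fun x => Q x v := hQ.clm (evalCLM v)

theorem D_eval {k : ℕ} {Q : Ω → Fiber k} (hQ : Smooth Q) (v : Fin k → 𝔥) (x : Ω) (w : Dual) :
    D (fun x => Q x v) x w = D Q x w v := D_clm hQ (evalCLM v) x w

/-- Insertion of a covector in the first argument, as a continuous linear map. -/
noncomputable def curryCLM (k : ℕ) : Fiber (k + 1) →L[ℝ] 𝔥 →L[ℝ] Fiber k :=
  ContinuousAlternatingMap.curryLeftLI.toContinuousLinearMap

@[simp] theorem curryCLM_apply {k : ℕ} (f : Fiber (k + 1)) (a : 𝔥) (v : Fin k → 𝔥) :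
    curryCLM k f a v = f (Matrix.vecCons a v) := rfl

theorem smooth_beta : Smooth fun x : Ω => beta x := Smooth.of_contDiff betaCLM.contDiff

/-- Contraction of a multivector field with the one-form `β`. -/
noncomputable def contr (k : ℕ) : V (k + 1) →ₗ[Cas] V k where
  toFun Q := ⟨fun x => curryCLM k (Q.val x) (beta x), (Q.smooth.clm (curryCLM k)).clm_apply
    smooth_beta⟩
  map_add' P Q := V.ext_val fun x => by simp
  map_smul' f Q := V.ext_val fun x => by simp

theorem contr_apply {k : ℕ} (Q : V (k + 1)) (x : Ω) (v : Fin k → 𝔥) :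
    (contr k Q).val x v = Q.val x (Matrix.vecCons (beta x) v) := rfl

/-- Leibniz rule; since β is linear in x, its derivative along ξ^# is -[ξ, β] by `beta_sharp`. -/
theorem D_contr {k : ℕ} (Q : V (k + 1)) (x : Ω) (ξ : 𝔥) (v : Fin k → 𝔥) :
    D (contr k Q).val x (sharp x ξ) v =
      D Q.val x (sharp x ξ) (Matrix.vecCons (beta x) v) -
        Q.val x (Matrix.vecCons ⁅ξ, beta x⁆ v) := by
  have h := D_clm_apply (Q.smooth.clm (curryCLM k)) smooth_beta x (sharp x ξ)
  have h' := congrArg (fun f => f v) h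
  have e : D (fun x : Ω => beta x) x = betaCLM := D_clm_coe betaCLM x
  rw [D_clm Q.smooth, e] at h'
  refine h'.trans ?_
  simp [beta_sharp, -lie_skew]
  ring

/-! ### The coboundary in low degrees -/

theorem sigmaAt_one_apply (Q : Ω → Fiber 1) (x : Ω) (a b : 𝔥) :
    sigmaAt 1 Q x ![a, b] =
      D Q x (sharp x a) ![b] - D Q x (sharp x b) ![a] - Q x ![⁅a, b⁆] := by
  have h0 : Fin.removeNth 0 ![a, b] = ![b] := by funext i; fin_cases i; rfl
  have h1 : Fin.removeNth 1 ![a, b] = ![a] := by funext i; fin_cases i; rfl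
  have hs : Finset.Ici (0 : Fin 1) = {0} := by decide
  rw [sigmaAt_succ, Fin.sum_univ_two, Fin.sum_univ_one, hs, Finset.sum_singleton]
  simp [h0, h1, -lie_skew]
  ring

theorem sigmaAt_two_apply (Q : Ω → Fiber 2) (x : Ω) (a b c : 𝔥) :
    sigmaAt 2 Q x ![a, b, c] =
      D Q x (sharp x a) ![b, c] - D Q x (sharp x b) ![a, c] + D Q x (sharp x c) ![a, b] -
        Q x ![⁅a, b⁆, c] + Q x ![⁅a, c⁆, b] - Q x ![⁅b, c⁆, a] := by
  have h0 : Fin.removeNth 0 ![a, b, c] = ![b, c] := by funext i; fin_cases i <;> rfl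
  have h1 : Fin.removeNth 1 ![a, b, c] = ![a, c] := by funext i; fin_cases i <;> rfl
  have h2 : Fin.removeNth 2 ![a, b, c] = ![a, b] := by funext i; fin_cases i <;> rfl
  have h3 (a b : 𝔥) : Fin.removeNth 0 ![a, b] = ![b] := by funext i; fin_cases i; rfl
  have h4 (a b : 𝔥) : Fin.removeNth 1 ![a, b] = ![a] := by funext i; fin_cases i; rfl
  have hs : Finset.Ici (0 : Fin 2) = {0, 1} := by decide
  have hs' : Finset.Ici (1 : Fin 2) = {1} := by decide
  rw [sigmaAt_succ, Fin.sum_univ_three, Fin.sum_univ_two, hs, hs', Finset.sum_singleton,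
    Finset.sum_pair (by decide)]
  simp [h0, h1, h2, h3, h4, -lie_skew]
  ring

theorem Fiber.zero_val {k : ℕ} (v : Fin k → 𝔥) : (0 : Fiber k) v = 0 := rfl

/-- In the Koszul formula with β in front, the derivative along β^# = 0 drops out, and the brackets
with β are exactly the terms produced by differentiating β in `D_contr`. The sign comes from moving
the other arguments past β. -/
theorem contr_sigma_one (Q : V 1) : contr 1 (sigma 1 Q) = -sigma 0 (contr 0 Q) := by
  refine V.ext_val fun x => Fiber.ext_one fun ξ => ?_
  rw [contr_apply, V.neg_val, ContinuousAlternatingMap.neg_apply, sigma_val, sigma_val,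
    sigmaAt_zero]
  have h := D_contr Q x ξ ![]
  rw [show Matrix.vecCons (beta x.1) ![ξ] = ![beta x.1, ξ] from rfl, sigmaAt_one_apply,
    sharp_beta, map_zero, ← lie_skew (beta x.1) ξ, Fiber.neg_head]
  simp only [Matrix.cons_val_zero, h, Fiber.zero_val]
  ring

theorem contr_sigma_two (Q : V 2) : contr 2 (sigma 2 Q) = -sigma 1 (contr 1 Q) := by
  refine V.ext_val fun x => ContinuousAlternatingMap.ext fun v => ?_
  rw [show v = ![v 0, v 1] by funext i; fin_cases i <;> rfl]
  generalize v 0 = ξ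
  generalize v 1 = η
  rw [contr_apply, V.neg_val, ContinuousAlternatingMap.neg_apply, sigma_val, sigma_val]
  have h1 := D_contr Q x ξ ![η]
  have h2 := D_contr Q x η ![ξ]
  rw [show Matrix.vecCons (beta x.1) ![ξ, η] = ![beta x.1, ξ, η] from rfl, sigmaAt_two_apply,
    sigmaAt_one_apply, sharp_beta, map_zero, ← lie_skew (beta x.1) ξ, ← lie_skew (beta x.1) η, Fiber.neg_head,
    Fiber.neg_head, h1, h2, contr_apply, (Q.val x).swap_two ⁅ξ, η⁆]
  simp only [Fiber.zero_val]
  ring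

/-! ### Tangential multivector fields -/

/-- The kernel of `sharp` is the line through β, so vanishing on β in the first slot suffices; other
slots reduce to it by a transposition. -/
theorem mem_Vtan_succ {k : ℕ} {Q : V (k + 1)} : Q ∈ Vtan (k + 1) ↔ contr k Q = 0 := by
  constructor
  · intro h
    exact V.ext_val fun x => ContinuousAlternatingMap.ext fun v =>
      h x (Matrix.vecCons (beta x) v) ⟨0, by simp⟩
  · intro h
    have key : ∀ (x : Ω) (v : Fin (k + 1) → 𝔥), sharp x (v 0) = 0 → Q.val x v = 0 := by
      intro x v hv
      obtain ⟨c, hc⟩ := exists_smul_beta x.2 hv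
      rw [show v = Matrix.vecCons (c • beta x) (Matrix.vecTail v) by
        rw [← hc]; exact (Matrix.cons_head_tail v).symm, Fiber.smul_head, ← contr_apply, h]
      simp
    rintro x v ⟨i, hi⟩
    by_cases h0 : i = 0
    · exact key x v (h0 ▸ hi)
    · have h1 := key x (v ∘ Equiv.swap 0 i) (by simpa using hi)
      have h2 := (Q.val x).toAlternatingMap.map_swap v (Ne.symm h0)
      exact neg_eq_zero.1 (h2.symm.trans h1)

theorem Vtan_zero : Vtan 0 = ⊤ := top_unique fun _ _ _ _ ⟨i, _⟩ => i.elim0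

theorem sigma_mem_Vtan_one (f : V 0) : sigma 0 f ∈ Vtan 1 := by
  rintro x v ⟨i, hi⟩
  rw [sigma_val, sigmaAt_zero, show (0 : Fin 1) = i from Subsingleton.elim _ _, hi]
  simp

theorem contr_contr {k : ℕ} (Q : V (k + 2)) : contr k (contr (k + 1) Q) = 0 := by
  refine V.ext_val fun x => ContinuousAlternatingMap.ext fun v => ?_
  rw [contr_apply, contr_apply]
  exact (Q.val x).map_eq_zero_of_eq _ (i := 0) (j := 1) rfl (by simp)

/-- The leaves have dimension 2. Concretely, for k = 3 inserting β against two pairs of basis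
covectors kills both x₂ and x₃ times the single coefficient of Q; beyond that, forms on a
3-dimensional space vanish. -/
theorem eq_zero_of_mem_Vtan {k : ℕ} (hk : 3 ≤ k) {Q : V k} (hQ : Q ∈ Vtan k) : Q = 0 := by
  obtain rfl | hk := hk.eq_or_lt
  · refine V.ext_val fun x => Fiber.ext_three ?_
    have hx : x.1 1 ^ 2 + x.1 2 ^ 2 ≠ 0 := x.2
    have h1 := hQ x ![beta x, X 0, X 1] ⟨0, by simp⟩
    have h2 := hQ x ![beta x, X 0, X 2] ⟨0, by simp⟩
    have s1 := (Q.val x).toAlternatingMap.map_swap ![X 0, X 1, X 2] (i := 0) (j := 1) (by decide)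
    have s2 := (Q.val x).toAlternatingMap.map_swap ![X 1, X 0, X 2] (i := 0) (j := 2) (by decide)
    rw [show ![X 0, X 1, X 2] ∘ Equiv.swap (0 : Fin 3) 1 = ![X 1, X 0, X 2] by
      funext i; fin_cases i <;> rfl] at s1
    rw [show ![X 1, X 0, X 2] ∘ Equiv.swap (0 : Fin 3) 2 = ![X 2, X 0, X 1] by
      funext i; fin_cases i <;> rfl] at s2
    have s1 : (Q.val x) ![X 1, X 0, X 2] = -(Q.val x) ![X 0, X 1, X 2] := s1
    have s2 : (Q.val x) ![X 2, X 0, X 1] = -(Q.val x) ![X 1, X 0, X 2] := s2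
    rw [beta, Fiber.add_head, Fiber.smul_head, Fiber.smul_head, s2, s1,
      (Q.val x).map_eq_zero_of_eq ![X 1, X 0, X 1] (i := 0) (j := 2) rfl (by decide)] at h1
    rw [beta, Fiber.add_head, Fiber.smul_head, Fiber.smul_head, s1,
      (Q.val x).map_eq_zero_of_eq ![X 2, X 0, X 2] (i := 0) (j := 2) rfl (by decide)] at h2
    have h3 : (x.1 1 ^ 2 + x.1 2 ^ 2) * (Q.val x) ![X 0, X 1, X 2] = 0 := by
      linear_combination x.1 1 * h1 - x.1 2 * h2
    simpa [hx] using h3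
  · exact V.ext_val fun x => Fiber.eq_of_four_le hk _ _

/-! ### Sections with given components -/

theorem V.smooth_eval {k : ℕ} (Q : V k) (v : Fin k → 𝔥) : Smooth fun x => Q.val x v :=
  Q.smooth.eval v

/-- The vector field `a ∂₁`. -/
noncomputable def vec₀ {a : Ω → ℝ} (ha : Smooth a) : V 1 where
  val := a • (fun _ => del 0)
  smooth := ha.smul (.const _)

theorem vec₀_val {a : Ω → ℝ} (ha : Smooth a) (x : Ω) (v : Fin 1 → 𝔥) :
    (vec₀ ha).val x v = a x * v 0 0 := rfl

theorem D_vec₀ {a : Ω → ℝ} (ha : Smooth a) (x : Ω) (w : Dual) (v : Fin 1 → 𝔥) :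
    D (vec₀ ha).val x w v = D a x w * v 0 0 := by
  rw [vec₀, D_smul ha (.const _), D_const]
  simp

theorem vec₀_mem_Vtan {a : Ω → ℝ} (ha : Smooth a) : vec₀ ha ∈ Vtan 1 := by
  rw [mem_Vtan_succ]
  refine V.ext_val fun x => ContinuousAlternatingMap.ext fun v => ?_
  rw [contr_apply, vec₀_val]
  simp

theorem sharp_X_zero (x : Dual) : sharp x (X 0) = pt 0 (x 1) (-x 2) := by
  rw [sharp_eq]; simp [X]

theorem sharp_X_one (x : Dual) : sharp x (X 1) = (-x 1) • e₀ := by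
  rw [sharp_eq]; ext i; fin_cases i <;> simp [X, pt, e₀]

theorem sharp_X_two (x : Dual) : sharp x (X 2) = x 2 • e₀ := by
  rw [sharp_eq]; ext i; fin_cases i <;> simp [X, pt, e₀]

/-- No bracket term survives because brackets in `𝔥` have no X₁-component. -/
theorem sigmaAt_vec₀ {a : Ω → ℝ} (ha : Smooth a) (x : Ω) (ξ η : 𝔥) :
    sigmaAt 1 (vec₀ ha).val x ![ξ, η] = D a x (sharp x ξ) * η 0 - D a x (sharp x η) * ξ 0 := by
  rw [sigmaAt_one_apply, D_vec₀, D_vec₀, vec₀_val]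
  simp

theorem smooth_coord (i : Fin 3) : Smooth fun x : Ω => x.1 i :=
  Smooth.of_contDiff (F := fun x => x i) (by fun_prop)

theorem Smooth.mul {f g : Ω → ℝ} (hf : Smooth f) (hg : Smooth g) :
    Smooth fun x => f x * g x := hf.smul hg

/-- The function `(x₂² + x₃²)⁻¹`. -/
noncomputable def invNormSq (x : Dual) : ℝ := (x 1 ^ 2 + x 2 ^ 2)⁻¹

theorem smooth_invNormSq : Smooth fun x : Ω => invNormSq x :=
  Smooth.congr (F := invNormSq) (ContDiffOn.inv (by fun_prop) fun _ hx => hx) fun _ => rfl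

/-- Tangential bivector fields are coboundaries of multiples of `∂₁`. -/
theorem exists_sigma_eq_of_mem_Vtan_two {W : V 2} (hW : W ∈ Vtan 2) :
    ∃ Q ∈ Vtan 1, sigma 1 Q = W := by
  -- The equation σ(a∂₁) = W amounts to x₂∂₁a = W(X₁, X₂) and -x₃∂₁a = W(X₁, X₃), with W(X₂, X₃) =
  -- 0. The least-squares value of ∂₁a is defined on all of Ω, and tangency of W makes the two
  -- equations compatible.
  obtain ⟨a, ha, hD⟩ := exists_primitive (f := fun x => invNormSq x *
      (x.1 1 * W.val x ![X 0, X 1] + -1 * (x.1 2 * W.val x ![X 0, X 2])))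
    (smooth_invNormSq.mul (((smooth_coord 1).mul (W.smooth_eval _)).add
      ((Smooth.const (-1)).mul ((smooth_coord 2).mul (W.smooth_eval _)))))
  refine ⟨vec₀ ha, vec₀_mem_Vtan ha, V.ext_val fun x => ?_⟩
  have hx : x.1 1 ^ 2 + x.1 2 ^ 2 ≠ 0 := x.2
  have hb (ξ : 𝔥) : x.1 1 * W.val x ![X 2, ξ] + x.1 2 * W.val x ![X 1, ξ] = 0 := by
    have := hW x ![beta x, ξ] ⟨0, by simp⟩
    rwa [beta, Fiber.add_head, Fiber.smul_head, Fiber.smul_head] at this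
  have h0 := hb (X 0)
  have h1 := hb (X 1)
  have h2 := hb (X 2)
  rw [Fiber.swap_two _ (X 2), Fiber.swap_two _ (X 1) (X 0)] at h0
  rw [Fiber.swap_two _ (X 2), show W.val x ![X 1, X 1] = 0 from
    (W.val x).map_eq_zero_of_eq _ (i := 0) (j := 1) rfl (by simp)] at h1
  rw [show W.val x ![X 2, X 2] = 0 from
    (W.val x).map_eq_zero_of_eq _ (i := 0) (j := 1) rfl (by simp)] at h2
  have h3 : (x.1 1 ^ 2 + x.1 2 ^ 2) * W.val x ![X 1, X 2] = 0 := by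
    linear_combination -x.1 1 * h1 + x.1 2 * h2
  have h3 := (mul_eq_zero.1 h3).resolve_left hx
  rw [sigma_val]
  apply Fiber.ext_two
  · rw [sigmaAt_vec₀, sharp_X_one, map_smul, hD]
    simp [X, invNormSq]
    field_simp
    linear_combination x.1 2 * h0
  · rw [sigmaAt_vec₀, sharp_X_two, map_smul, hD]
    simp [X, invNormSq]
    field_simp
    linear_combination x.1 1 * h0
  · rw [sigmaAt_vec₀, h3]
    simp [X]

/-! ### Sections with a given contraction -/

theorem transv_val (x : Ω) (v : Fin 1 → 𝔥) :
    transv.val x v = invNormSq x * (x.1 1 * v 0 2 + x.1 2 * v 0 1) := rfl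

theorem transv_beta (x : Ω) : transv.val x ![beta x] = 1 := by
  have hx : x.1 1 ^ 2 + x.1 2 ^ 2 ≠ 0 := x.2
  rw [transv_val, invNormSq]
  simp
  field_simp

theorem exists_contr_zero_eq (f : V 0) : ∃ Q, contr 0 Q = f := by
  refine ⟨⟨_, (f.smooth_eval ![]).smul transv.smooth⟩, V.ext_val fun x =>
    ContinuousAlternatingMap.ext fun v => ?_⟩
  rw [contr_apply, Subsingleton.elim v ![]]
  change f.val x ![] * transv.val x ![beta x] = _
  rw [transv_beta, mul_one]

/-- The bivector field `∑ f_i g_j ∂_i ∧ ∂_j`, the exterior product of two vector fields. -/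
noncomputable def wedge (P Q : V 1) : V 2 where
  val := ∑ i, ∑ j, (fun x => P.val x ![X i] * Q.val x ![X j]) • fun _ => del₂ i j
  smooth := by
    simp only [Fin.sum_univ_three]
    have h (i j) : Smooth ((fun x => P.val x ![X i] * Q.val x ![X j]) • fun _ => del₂ i j) :=
      ((P.smooth_eval _).mul (Q.smooth_eval _)).smul (.const _)
    exact ((((h 0 0).add (h 0 1)).add (h 0 2)).add (((h 1 0).add (h 1 1)).add (h 1 2))).add
      (((h 2 0).add (h 2 1)).add (h 2 2))

theorem wedge_val (P Q : V 1) (x : Ω) (a b : 𝔥) :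
    (wedge P Q).val x ![a, b] =
      P.val x ![a] * Q.val x ![b] - P.val x ![b] * Q.val x ![a] := by
  rw [(P.val x).one_apply a, (P.val x).one_apply b, (Q.val x).one_apply a, (Q.val x).one_apply b]
  simp [wedge, Fin.sum_univ_three]
  ring

/-- Take X ∧ A: β(X) = 1 and β(A) = 0. -/
theorem exists_contr_one_eq {A : V 1} (hA : A ∈ Vtan 1) : ∃ W, contr 1 W = A := by
  refine ⟨wedge transv A, V.ext_val fun x => Fiber.ext_one fun ξ => ?_⟩
  have hβ : A.val x ![beta x] = 0 := hA x _ ⟨0, by simp⟩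
  rw [contr_apply]
  exact (wedge_val _ _ _ _ _).trans (by rw [transv_beta, hβ]; ring)

/-- A trivector field is determined by its contraction with β, tangential trivectors being zero.
That contraction is a tangential bivector σA, and a lift of A to a bivector, with its sign changed,
is a primitive of T. -/
theorem exists_sigma_two_eq (T : V 3) : ∃ W, sigma 2 W = T := by
  obtain ⟨A, hA, hAT⟩ := exists_sigma_eq_of_mem_Vtan_two (W := contr 2 T)
    (mem_Vtan_succ.2 (contr_contr T))
  obtain ⟨W, rfl⟩ := exists_contr_one_eq hA
  refine ⟨-W, sub_eq_zero.1 (eq_zero_of_mem_Vtan le_rfl (mem_Vtan_succ.2 ?_))⟩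
  rw [map_sub, contr_sigma_two, map_neg, map_neg, neg_neg, hAT, sub_self]

/-! ### Degree zero and large degrees -/

/-- A smooth function as a section of `⋀⁰`. -/
noncomputable def fn {f : Ω → ℝ} (hf : Smooth f) : V 0 where
  val x := ContinuousAlternatingMap.constOfIsEmpty ℝ 𝔥 (Fin 0) (f x)
  smooth := by
    have h := hf.smul (.const (ContinuousAlternatingMap.constOfIsEmpty ℝ 𝔥 (Fin 0) (1 : ℝ)))
    refine (congrArg Smooth ?_).mp h
    funext x
    ext v
    simp

theorem sigma_zero_eq_zero {f : V 0} :
    sigma 0 f = 0 ↔ ∀ (x : Ω) (ξ : 𝔥), D (fun x => f.val x ![]) x (sharp x ξ) = 0 := by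
  constructor
  · intro h x ξ
    have := congrArg (fun Q => Q.val x ![ξ]) h
    rw [D_eval f.smooth]
    simpa [sigmaAt_zero] using this
  · intro h
    refine V.ext_val fun x => Fiber.ext_one fun ξ => ?_
    rw [sigma_val, sigmaAt_zero, ← D_eval f.smooth, h]
    rfl

/-- Degree-zero cocycles are the Casimir functions. -/
noncomputable def cocyclesZeroEquiv : cocycles 0 ≃ₗ[Cas] Cas where
  toFun f := ⟨fun x => f.1.val x ![], f.1.smooth_eval _, sigma_zero_eq_zero.1 f.2⟩
  map_add' _ _ := rfl
  map_smul' _ _ := rfl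
  invFun f := ⟨fn f.smooth, sigma_zero_eq_zero.2 f.casimir⟩
  left_inv f := Subtype.ext <| V.ext_val fun x => ContinuousAlternatingMap.ext fun v => by
    rw [Subsingleton.elim v ![]]; rfl
  right_inv _ := rfl

theorem submoduleOf_bot {M : Type*} [AddCommGroup M] [Module Cas M] (N : Submodule Cas M) :
    (⊥ : Submodule Cas M).submoduleOf N = ⊥ :=
  (Submodule.comap_bot _).trans N.ker_subtype

theorem nonempty_H_zero : Nonempty (H 0 ≃ₗ[Cas] Cas) :=
  ⟨(Submodule.quotEquivOfEqBot _ (submoduleOf_bot _)).trans cocyclesZeroEquiv⟩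

theorem nonempty_Htan_zero : Nonempty (Htan 0 ≃ₗ[Cas] Cas) :=
  ⟨((Submodule.quotEquivOfEqBot _ (submoduleOf_bot _)).trans
    (LinearEquiv.ofEq (cocyclesTan 0) (cocycles 0)
      (by rw [cocyclesTan, Vtan_zero, inf_top_eq]))).trans cocyclesZeroEquiv⟩

theorem subsingleton_quotient_submoduleOf {M : Type*} [AddCommGroup M] [Module Cas M]
    {N P : Submodule Cas M} (h : N ≤ P) : Subsingleton (N ⧸ P.submoduleOf N) := by
  rw [Submodule.Quotient.subsingleton_iff]
  exact Submodule.submoduleOf_eq_top.2 h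

theorem subsingleton_Htan {k : ℕ} (hk : 1 < k) : Subsingleton (Htan k) := by
  apply subsingleton_quotient_submoduleOf
  intro Q hQ
  obtain _ | _ | _ | k := k
  · omega
  · omega
  · obtain ⟨P, hP, rfl⟩ := exists_sigma_eq_of_mem_Vtan_two hQ.2
    exact Submodule.mem_map_of_mem hP
  · rw [eq_zero_of_mem_Vtan (by omega) hQ.2]
    exact zero_mem _

theorem subsingleton_H {k : ℕ} (hk : 2 < k) : Subsingleton (H k) := by
  apply subsingleton_quotient_submoduleOf
  intro Q hQ
  obtain _ | _ | _ | _ | k := k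
  · omega
  · omega
  · omega
  · exact exists_sigma_two_eq Q
  · rw [V.ext_val (P := Q) (Q := 0) fun x => Fiber.eq_of_four_le (by omega) _ _]
    exact zero_mem _

/-! ### Degree one -/

/-- The transverse part `β(Q)` of a Poisson vector field `Q`, a Casimir function. -/
noncomputable def transPart : cocycles 1 →ₗ[Cas] Cas where
  toFun Q := cocyclesZeroEquiv ⟨contr 0 Q.1, by
    have h := contr_sigma_one Q.1
    rw [show sigma 1 Q.1 = 0 from Q.2, map_zero] at h
    exact (neg_eq_zero.1 h.symm)⟩
  map_add' P Q := rfl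
  map_smul' f Q := rfl

theorem transPart_val (Q : cocycles 1) (x : Ω) :
    (transPart Q).val x = Q.1.val x ![beta x] := rfl

theorem transPart_eq_zero {Q : cocycles 1} : transPart Q = 0 ↔ Q.1 ∈ Vtan 1 := by
  rw [mem_Vtan_succ]
  constructor
  · intro h
    refine V.ext_val fun x => ContinuousAlternatingMap.ext fun v => ?_
    rw [Subsingleton.elim v ![]]
    exact congrArg (fun f => f.val x) h
  · intro h
    ext x
    exact congrArg (fun f => f.val x ![]) h

/-- A tangential correction of `transv` is a Poisson vector field. -/
theorem exists_cocycle_transPart_eq_one : ∃ Q : cocycles 1, transPart Q = 1 := by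
  have hβ (x : Ω) (v : Fin 0 → 𝔥) : (contr 0 transv).val x v = 1 := by
    rw [Subsingleton.elim v ![]]; exact transv_beta x
  -- The contraction of σX is -σ(β(X)) = -σ(1) = 0, so σX is tangential and hence has a tangential
  -- primitive to subtract.
  have h : sigma 1 transv ∈ Vtan 2 := by
    rw [mem_Vtan_succ, contr_sigma_one, neg_eq_zero, sigma_zero_eq_zero]
    intro x ξ
    simp only [hβ, D_const, _root_.zero_apply]
  obtain ⟨Q, hQ, hQs⟩ := exists_sigma_eq_of_mem_Vtan_two h
  refine ⟨⟨transv - Q, ?_⟩, ?_⟩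
  · rw [cocycles, LinearMap.mem_ker, map_sub, hQs, sub_self]
  · ext x
    have h1 : Q.val x ![beta x] = 0 := hQ x _ ⟨0, by simp⟩
    rw [transPart_val]
    have h2 := congrArg (fun P => P.val x ![beta x]) (sub_eq_add_neg transv Q)
    refine h2.trans ?_
    change transv.val x ![beta x] + -Q.val x ![beta x] = 1
    rw [transv_beta, h1, neg_zero, add_zero]

/-- The tangential part `Q - β(Q) N` of a Poisson vector field `Q`. -/
noncomputable def tanPart {N : cocycles 1} (hN : transPart N = 1) :
    cocycles 1 →ₗ[Cas] cocyclesTan 1 where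
  toFun Q := ⟨(Q - transPart Q • N).1, (Q - transPart Q • N).2, transPart_eq_zero.1 (by
    rw [map_sub, map_smul, hN, smul_eq_mul, mul_one, sub_self])⟩
  map_add' P Q := Subtype.ext <| congrArg (fun R : cocycles 1 => R.1)
    (show P + Q - transPart (P + Q) • N = (P - transPart P • N) + (Q - transPart Q • N) by
      rw [map_add, add_smul]; abel)
  map_smul' f Q := Subtype.ext <| congrArg (fun R : cocycles 1 => R.1)
    (show f • Q - transPart (f • Q) • N = f • (Q - transPart Q • N) by
      rw [map_smul, smul_eq_mul, mul_smul, smul_sub])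

/-- The class of the tangential part and the transverse part of a Poisson vector field. -/
noncomputable def splitMap {N : cocycles 1} (hN : transPart N = 1) :
    cocycles 1 →ₗ[Cas] Htan 1 × Submodule.span Cas {transv} :=
  LinearMap.prod (((coboundariesTan 1).submoduleOf (cocyclesTan 1)).mkQ ∘ₗ tanPart hN)
    (transPart.smulRight ⟨transv, Submodule.mem_span_singleton_self _⟩)

theorem splitMap_snd_val {N : cocycles 1} (hN : transPart N = 1) (Q : cocycles 1) :
    (splitMap hN Q).2.1 = transPart Q • transv := rfl

theorem splitMap_tan {N : cocycles 1} (hN : transPart N = 1) (A : cocyclesTan 1) :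
    splitMap hN (tanIncl 1 A) = (Htan.mk A, 0) := by
  have h : transPart (tanIncl 1 A) = 0 := transPart_eq_zero.2 A.2.2
  refine Prod.ext ?_ (Subtype.ext ?_)
  · refine congrArg Submodule.Quotient.mk (Subtype.ext ?_)
    change ((tanIncl 1 A).1 - transPart (tanIncl 1 A) • N.1) = A.1
    rw [h, zero_smul, sub_zero]
    rfl
  · rw [splitMap_snd_val, h, zero_smul]; rfl

theorem smul_transv_eq_zero {f : Cas} (h : f • transv = 0) : f = 0 := by
  ext x
  have := congrArg (fun Q => Q.val x ![beta x]) h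
  change f.val x * transv.val x ![beta x] = 0 at this
  rwa [transv_beta, mul_one] at this

/-- The coboundaries in degree 1 are the same for both complexes: every function is a tangential
0-field and σf is always tangential. -/
theorem ker_splitMap {N : cocycles 1} (hN : transPart N = 1) :
    LinearMap.ker (splitMap hN) = (coboundaries 1).submoduleOf (cocycles 1) := by
  ext Q
  rw [LinearMap.mem_ker]
  constructor
  · intro h
    have h2 : transPart Q = 0 := smul_transv_eq_zero (congrArg (fun z => z.2.1) h)
    let A : cocyclesTan 1 := ⟨Q.1, Q.2, transPart_eq_zero.1 h2⟩
    have h3 : (Htan.mk A, (0 : Submodule.span Cas {transv})) = 0 :=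
      (splitMap_tan hN A).symm.trans h
    have h4 : Htan.mk A = 0 := congrArg Prod.fst h3
    obtain ⟨f, -, hf⟩ := (Submodule.Quotient.mk_eq_zero _).1 h4
    exact ⟨f, hf⟩
  · rintro ⟨f, hf⟩
    have hf : sigma 0 f = Q.1 := hf
    let A : cocyclesTan 1 := ⟨Q.1, Q.2, hf ▸ sigma_mem_Vtan_one f⟩
    have h4 : Htan.mk A = 0 := (Submodule.Quotient.mk_eq_zero _).2
      ⟨f, by rw [Vtan_zero]; trivial, hf⟩
    refine (splitMap_tan hN A).trans ?_
    rw [h4]; rfl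

theorem splitMap_surjective {N : cocycles 1} (hN : transPart N = 1) :
    Function.Surjective (splitMap hN) := by
  rintro ⟨a, b, hb⟩
  obtain ⟨A, rfl⟩ := Submodule.Quotient.mk_surjective _ a
  obtain ⟨f, rfl⟩ := Submodule.mem_span_singleton.1 hb
  refine ⟨tanIncl 1 A + f • N, ?_⟩
  rw [map_add, splitMap_tan, map_smul]
  have h : splitMap hN N = (0, ⟨transv, Submodule.mem_span_singleton_self _⟩) := by
    refine Prod.ext ?_ (Subtype.ext ?_)
    · refine (Submodule.Quotient.mk_eq_zero _).2 ?_
      convert Submodule.zero_mem _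
      refine Subtype.ext ?_
      change N.1 - transPart N • N.1 = 0
      rw [hN, one_smul, sub_self]
    · rw [splitMap_snd_val, hN, one_smul]
  rw [h]
  refine Prod.ext (by simp [Htan.mk]) (Subtype.ext (by simp))

theorem exists_H_one_equiv :
    ∃ e : H 1 ≃ₗ[Cas] Htan 1 × Submodule.span Cas {transv},
      (∀ A : cocyclesTan 1, e (H.mk (tanIncl 1 A)) = (Htan.mk A, 0)) ∧
      ∀ (Q : cocycles 1) (x : Ω) (ξ : 𝔥),
        (e (H.mk Q)).2.1.val x ![ξ] = Q.1.val x ![beta x] * transv.val x ![ξ] := by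
  obtain ⟨N, hN⟩ := exists_cocycle_transPart_eq_one
  exact ⟨(Submodule.quotEquivOfEq _ _ (ker_splitMap hN).symm).trans
    (LinearMap.quotKerEquivOfSurjective _ (splitMap_surjective hN)),
    splitMap_tan hN, fun _ _ _ => rfl⟩

/-! ### Degree two -/

/-- The class of the contraction with `β` of a Poisson bivector field. -/
noncomputable def contrClass : cocycles 2 →ₗ[Cas] Htan 1 :=
  ((coboundariesTan 1).submoduleOf (cocyclesTan 1)).mkQ ∘ₗ
    LinearMap.codRestrict (cocyclesTan 1) (contr 1 ∘ₗ (cocycles 2).subtype) fun W =>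
      ⟨by
        have h := contr_sigma_two W.1
        rw [show sigma 2 W.1 = 0 from W.2, map_zero] at h
        exact neg_eq_zero.1 h.symm, mem_Vtan_succ.2 (contr_contr _)⟩

theorem contrClass_eq_zero {W : cocycles 2} :
    contrClass W = 0 ↔ ∃ f, sigma 0 f = contr 1 W.1 := by
  refine (Submodule.Quotient.mk_eq_zero _).trans ?_
  constructor
  · rintro ⟨f, -, hf⟩
    exact ⟨f, hf⟩
  · rintro ⟨f, hf⟩
    exact ⟨f, by rw [Vtan_zero]; trivial, hf⟩

/-- If the contraction of W is σf, lift f to a vector field Q with β(Q) = f; then W + σQ is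
tangential, hence exact. The converse is anticommutation. -/
theorem ker_contrClass :
    LinearMap.ker contrClass = (coboundaries 2).submoduleOf (cocycles 2) := by
  ext W
  rw [LinearMap.mem_ker, contrClass_eq_zero]
  constructor
  · rintro ⟨f, hf⟩
    obtain ⟨Q, rfl⟩ := exists_contr_zero_eq f
    obtain ⟨P, -, hP⟩ := exists_sigma_eq_of_mem_Vtan_two (W := W.1 + sigma 1 Q)
      (mem_Vtan_succ.2 (by rw [map_add, contr_sigma_one, hf, add_neg_cancel]))
    exact ⟨P - Q, by rw [map_sub, hP, add_sub_cancel_right]; rfl⟩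
  · rintro ⟨Q, hQ⟩
    exact ⟨-contr 0 Q, by rw [map_neg, ← contr_sigma_one, hQ]; rfl⟩

/-- Any lift W of a tangential cocycle A is closed: σW contracts to -σA = 0, so it is a tangential
trivector. -/
theorem contrClass_surjective : Function.Surjective contrClass := by
  intro a
  obtain ⟨A, rfl⟩ := Submodule.Quotient.mk_surjective _ a
  obtain ⟨W, hW⟩ := exists_contr_one_eq A.2.2
  refine ⟨⟨W, eq_zero_of_mem_Vtan le_rfl (mem_Vtan_succ.2 ?_)⟩,
    congrArg Submodule.Quotient.mk (Subtype.ext hW)⟩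
  rw [contr_sigma_two, hW, show sigma 1 A.1 = 0 from A.2.1, neg_zero]

theorem nonempty_H_two : Nonempty (H 2 ≃ₗ[Cas] Htan 1) :=
  ⟨(Submodule.quotEquivOfEq _ _ ker_contrClass.symm).trans
    (LinearMap.quotKerEquivOfSurjective _ contrClass_surjective)⟩

/-! ### Infinite dimensionality -/

/-- All three scalar rings act through `Cas`, so finite generation over any of them would give it
over `Cas`. -/
theorem isInfDim_of_not_finite {M : Type} [AddCommGroup M] [Module Cas M]
    (h : ¬ Module.Finite Cas M) : IsInfDim M :=
  ⟨fun _ =>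
      letI := RestrictScalars.moduleOrig ℝ Cas M
      h (Module.Finite.of_restrictScalars_finite ℝ Cas (RestrictScalars ℝ Cas M)),
    fun _ => h (Module.Finite.of_restrictScalars_finite polyInv Cas M),
    fun _ => h (Module.Finite.of_restrictScalars_finite anaInv Cas M)⟩

/-- The integral curve of `H_{x₁}` through `(0, e^s, e^s)`. -/
noncomputable def curve (s t : ℝ) : Dual := pt 0 (Real.exp (s + t)) (Real.exp (s - t))

theorem curve_mem_Ω (s t : ℝ) : curve s t ∈ Ω := pt_mem_Ω.2 (by positivity)

theorem hasDerivAt_curve (s t : ℝ) : HasDerivAt (curve s) (sharp (curve s t) (X 0)) t := by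
  rw [sharp_X_zero]
  refine hasDerivAt_pi.2 fun i => ?_
  fin_cases i
  · exact hasDerivAt_const t _
  · simpa [curve, pt] using ((hasDerivAt_id t).const_add s).exp
  · simpa [curve, pt] using ((hasDerivAt_id t).const_sub s).exp

theorem continuous_curve : Continuous fun q : ℝ × ℝ => curve q.1 q.2 := by
  refine continuous_pi fun i => ?_
  fin_cases i <;> simp [curve, pt] <;> fun_prop

theorem Smooth.continuous_comp {f : Ω → ℝ} (hf : Smooth f) {T : Type*} [TopologicalSpace T]
    {c : T → Dual} (hc : Continuous c) (hΩ : ∀ t, c t ∈ Ω) : Continuous fun t => ext0 f (c t) :=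
  ContDiffOn.continuousOn hf |>.comp_continuous hc hΩ

/-- The integral of a function along an integral curve of `H_{x₁}`, between the points
`(0, e^{2s}, 1)` and `(0, 1, e^{2s})`. -/
noncomputable def curveIntegral (f : Ω → ℝ) (s : ℝ) : ℝ := ∫ t in s..-s, ext0 f (curve s t)

theorem Smooth.continuous_curve {f : Ω → ℝ} (hf : Smooth f) :
    Continuous fun q : ℝ × ℝ => ext0 f (curve q.1 q.2) :=
  hf.continuous_comp LiePoissonH.continuous_curve fun _ => curve_mem_Ω _ _

theorem Smooth.continuous_curve_right {f : Ω → ℝ} (hf : Smooth f) (s : ℝ) :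
    Continuous fun t => ext0 f (curve s t) :=
  hf.continuous_curve.comp (by fun_prop : Continuous fun t => (s, t))

theorem continuous_curveIntegral {f : Ω → ℝ} (hf : Smooth f) : Continuous (curveIntegral f) := by
  have h : curveIntegral f = fun s =>
      (∫ t in (0 : ℝ)..-s, ext0 f (curve s t)) - ∫ t in (0 : ℝ)..s, ext0 f (curve s t) := by
    funext s
    exact (intervalIntegral.integral_interval_sub_left
      ((hf.continuous_curve_right s).intervalIntegrable _ _)
      ((hf.continuous_curve_right s).intervalIntegrable _ _)).symm
  rw [h]
  exact (intervalIntegral.continuous_parametric_intervalIntegral_of_continuous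
    hf.continuous_curve continuous_neg).sub
    (intervalIntegral.continuous_parametric_intervalIntegral_of_continuous
      hf.continuous_curve continuous_id)

theorem curveIntegral_add {f g : Ω → ℝ} (hf : Smooth f) (hg : Smooth g) (s : ℝ) :
    curveIntegral (fun x => f x + g x) s = curveIntegral f s + curveIntegral g s := by
  rw [curveIntegral, curveIntegral, curveIntegral, ← intervalIntegral.integral_add
    ((hf.continuous_curve_right s).intervalIntegrable _ _)
    ((hg.continuous_curve_right s).intervalIntegrable _ _)]
  congr 1
  funext t
  rw [ext0_coe f ⟨_, curve_mem_Ω s t⟩, ext0_coe g ⟨_, curve_mem_Ω s t⟩,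
    ext0_coe (fun x => f x + g x) ⟨_, curve_mem_Ω s t⟩]

theorem Cas.curve_eq (f : Cas) (s t : ℝ) : ext0 f.val (curve s t) = ext0 f.val (curve s (-s)) := by
  have h (t : ℝ) : HasDerivAt (fun t => ext0 f.val (curve s t)) 0 t := by
    have := hasDerivAt_comp_curve f.smooth (hasDerivAt_curve s t) (curve_mem_Ω s t)
    rwa [f.casimir ⟨_, curve_mem_Ω s t⟩] at this
  exact is_const_of_deriv_eq_zero (fun t => (h t).differentiableAt) (fun t => (h t).deriv) _ _

theorem curveIntegral_cas_mul (f : Cas) (g : Ω → ℝ) (s : ℝ) :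
    curveIntegral (fun x => f.val x * g x) s =
      ext0 f.val (curve s (-s)) * curveIntegral g s := by
  rw [curveIntegral, curveIntegral, ← intervalIntegral.integral_const_mul]
  congr 1
  funext t
  rw [← f.curve_eq s t, ext0_coe f.val ⟨_, curve_mem_Ω s t⟩, ext0_coe g ⟨_, curve_mem_Ω s t⟩,
    ext0_coe (fun x => f.val x * g x) ⟨_, curve_mem_Ω s t⟩]

theorem curveIntegral_sharp {g : Ω → ℝ} (hg : Smooth g) {a : Ω → ℝ} (ha : Smooth a)
    (h : ∀ x : Ω, a x = D g x (sharp x (X 0))) (s : ℝ) :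
    curveIntegral a s = ext0 g (curve s (-s)) - ext0 g (curve s s) := by
  refine intervalIntegral.integral_eq_sub_of_hasDerivAt (f := fun t => ext0 g (curve s t))
    (fun t _ => ?_) ((ha.continuous_curve_right s).intervalIntegrable _ _)
  rw [ext0_coe a ⟨_, curve_mem_Ω s t⟩, h]
  exact hasDerivAt_comp_curve hg (hasDerivAt_curve s t) (curve_mem_Ω s t)

/-! ### Growth of arc integrals as the arcs approach the axes. -/

open Filter Topology Asymptotics

theorem tendsto_exp_two_mul : Tendsto (fun s : ℝ => Real.exp (s + s)) atBot (𝓝 0) :=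
  Real.tendsto_exp_atBot.comp (tendsto_id.atBot_add_atBot tendsto_id)

theorem tendsto_ext0 {g : Ω → ℝ} (hg : Smooth g) {c : ℝ → Dual} {x : Dual} (hx : x ∈ Ω)
    {l : Filter ℝ} (hc : Tendsto c l (𝓝 x)) : Tendsto (fun s => ext0 g (c s)) l (𝓝 (ext0 g x)) :=
  (hg.diffAt ⟨x, hx⟩).continuousAt.tendsto.comp hc

/-- As s → -∞ the starting point tends to (0, 0, 1), which is still in Ω, so g converges there. -/
theorem isBigO_curve_left {g : Ω → ℝ} (hg : Smooth g) :
    (fun s => ext0 g (curve s s)) =O[atBot] (fun _ => (1 : ℝ)) := by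
  refine (tendsto_ext0 hg (x := pt 0 0 1) (pt_mem_Ω.2 (by norm_num)) ?_).isBigO_one ℝ
  refine tendsto_pi_nhds.2 fun i => ?_
  fin_cases i
  · exact tendsto_const_nhds
  · exact tendsto_exp_two_mul
  · simp [curve, pt]

theorem isBigO_curve_right {g : Ω → ℝ} (hg : Smooth g) :
    (fun s => ext0 g (curve s (-s))) =O[atBot] (fun _ => (1 : ℝ)) := by
  refine (tendsto_ext0 hg (x := pt 0 1 0) (pt_mem_Ω.2 (by norm_num)) ?_).isBigO_one ℝ
  refine tendsto_pi_nhds.2 fun i => ?_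
  fin_cases i
  · exact tendsto_const_nhds
  · simp [curve, pt]
  · exact tendsto_exp_two_mul.congr fun s => by simp [curve, pt]

/-- The `∂₁`-component of a vector field. -/
noncomputable def comp₀ (A : V 1) : Ω → ℝ := fun x => A.val x ![X 0]

theorem smooth_comp₀ (A : V 1) : Smooth (comp₀ A) := A.smooth_eval _

/-- The tangential cocycles whose integrals along the integral curves of `H_{x₁}` are `O(B)`. -/
noncomputable def boundedCocycles (B : ℝ → ℝ) : Submodule Cas (cocyclesTan 1) where
  carrier := {A | curveIntegral (comp₀ A.1) =O[atBot] B}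
  add_mem' {P Q} hP hQ := by
    have h : curveIntegral (comp₀ (P + Q).1) =
        fun s => curveIntegral (comp₀ P.1) s + curveIntegral (comp₀ Q.1) s :=
      funext (curveIntegral_add (smooth_comp₀ _) (smooth_comp₀ _))
    change curveIntegral (comp₀ (P + Q).1) =O[atBot] B
    rw [h]
    exact hP.add hQ
  zero_mem' := by
    have h := funext (curveIntegral_cas_mul 0 (comp₀ 0))
    have h' : (fun x => (0 : Cas).val x * comp₀ 0 x) = comp₀ 0 := by
      funext x; simp [comp₀]
    rw [h'] at h
    change curveIntegral (comp₀ 0) =O[atBot] B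
    have h0 (s : ℝ) : ext0 (0 : Cas).val (curve s (-s)) = 0 :=
      ext0_coe (0 : Cas).val ⟨_, curve_mem_Ω _ _⟩
    simp only [h0, zero_mul] at h
    rw [h]
    exact isBigO_zero _ _
  smul_mem' f P hP := by
    have h : curveIntegral (comp₀ (f • P).1) =
        fun s => ext0 f.val (curve s (-s)) * curveIntegral (comp₀ P.1) s :=
      funext (curveIntegral_cas_mul f (comp₀ P.1))
    change curveIntegral (comp₀ (f • P).1) =O[atBot] B
    rw [h]
    -- A Casimir is constant on the arc, so it contributes its endpoint value, which is O(1); this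
    -- is what makes the growth condition stable under `Cas`.
    simpa using (isBigO_curve_right f.smooth).mul hP

theorem coboundariesTan_le_boundedCocycles {B : ℝ → ℝ} (hB : (fun _ => (1 : ℝ)) =O[atBot] B) :
    (coboundariesTan 1).submoduleOf (cocyclesTan 1) ≤ boundedCocycles B := by
  rintro A ⟨g, -, hg⟩
  have hg : sigma 0 g = A.1 := hg
  have h : curveIntegral (comp₀ A.1) = fun s => ext0 (fun x => g.val x ![]) (curve s (-s)) -
      ext0 (fun x => g.val x ![]) (curve s s) := by
    refine funext (curveIntegral_sharp (g.smooth_eval _) (smooth_comp₀ _) fun x => ?_)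
    rw [comp₀, ← hg, sigma_val, sigmaAt_zero, D_eval g.smooth]
    rfl
  change curveIntegral (comp₀ A.1) =O[atBot] B
  rw [h]
  exact ((isBigO_curve_right (g.smooth_eval _)).sub (isBigO_curve_left (g.smooth_eval _))).trans hB

/-- A continuous function has a smooth majorant that also dominates its earlier values. -/
theorem exists_smooth_majorant {G : ℝ → ℝ} (hG : Continuous G) :
    ∃ K : ℝ → ℝ, ContDiff ℝ ∞ K ∧ ∀ τ, ∀ s ∈ Set.Icc (τ - 2) τ, G s ≤ K τ := by
  -- The condition on K τ is convex and locally solved by a constant, so a partition of unity glues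
  -- solutions. The maximum of G over [τ - 3, τ + 1] serves all τ' within distance 1 of τ.
  obtain ⟨K, hK⟩ := exists_contMDiffMap_forall_mem_convex_of_local_const (n := (⊤ : ℕ∞))
    (modelWithCornersSelf ℝ ℝ) (t := fun τ => {c : ℝ | ∀ s ∈ Set.Icc (τ - 2) τ, G s ≤ c})
    (fun τ => by
      rw [Set.ofPred_forall]
      refine convex_iInter fun s => ?_
      rw [Set.ofPred_forall]
      exact convex_iInter fun _ => convex_Ici (G s))
    (fun τ => by
      obtain ⟨c, hc⟩ := (isCompact_Icc (a := τ - 3) (b := τ + 1)).bddAbove_image hG.continuousOn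
      refine ⟨c, ?_⟩
      filter_upwards [Icc_mem_nhds (show τ - 1 < τ by linarith) (show τ < τ + 1 by linarith)]
        with τ' hτ' s hs
      exact hc ⟨s, ⟨by linarith [hτ'.1, hs.1], by linarith [hτ'.2, hs.2]⟩, rfl⟩)
  exact ⟨K, K.contMDiff.contDiff, hK⟩

/-! ### Tangential cocycles of arbitrarily fast growth. -/

theorem vec₀_mem_cocyclesTan {a : Ω → ℝ} (ha : Smooth a) (h : ∀ x, D a x e₀ = 0) :
    vec₀ ha ∈ cocyclesTan 1 := by
  refine ⟨V.ext_val fun x => ?_, vec₀_mem_Vtan ha⟩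
  rw [sigma_val]
  apply Fiber.ext_two
  · rw [sigmaAt_vec₀, sharp_X_one, map_smul, h]
    simp [X]
  · rw [sigmaAt_vec₀, sharp_X_two, map_smul, h]
    simp [X]
  · rw [sigmaAt_vec₀]
    simp [X]

/-- The logarithm of `x₂² + x₃²`. -/
noncomputable def logNormSq (x : Dual) : ℝ := Real.log (x 1 ^ 2 + x 2 ^ 2)

theorem smooth_comp_logNormSq {K : ℝ → ℝ} (hK : ContDiff ℝ ∞ K) :
    Smooth fun x : Ω => K (logNormSq x) :=
  Smooth.congr (F := fun x => K (logNormSq x))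
    (hK.comp_contDiffOn (ContDiffOn.log (by fun_prop) fun _ hx => hx)) fun _ => rfl

theorem D_comp_logNormSq {K : ℝ → ℝ} (hK : ContDiff ℝ ∞ K) (x : Ω) :
    D (fun x : Ω => K (logNormSq x)) x e₀ = 0 := by
  have hc : HasDerivAt (fun t : ℝ => x.1 + t • e₀) e₀ 0 := by
    simpa using ((hasDerivAt_id (0 : ℝ)).smul_const e₀).const_add x.1
  have hx : x.1 + (0 : ℝ) • e₀ = x := by simp
  have hmem (t : ℝ) : x.1 + t • e₀ ∈ Ω := by
    have : x.1 1 ^ 2 + x.1 2 ^ 2 ≠ 0 := x.2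
    have h : x.1 + t • e₀ = pt (x.1 0 + t) (x.1 1) (x.1 2) := by
      ext i; fin_cases i <;> simp [e₀, pt]
    rw [h]
    exact pt_mem_Ω.2 this
  have h1 := hasDerivAt_comp_curve (smooth_comp_logNormSq hK) hc (hmem 0)
  have h2 : (fun t : ℝ => ext0 (fun x : Ω => K (logNormSq x)) (x.1 + t • e₀)) =
      fun _ => K (logNormSq x) := by
    funext t
    rw [ext0_coe (fun x : Ω => K (logNormSq x)) ⟨_, hmem t⟩]
    simp [logNormSq, e₀, pt]
  rw [h2] at h1
  have h3 := h1.unique (hasDerivAt_const (0 : ℝ) _)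
  rwa [show (⟨_, hmem 0⟩ : Ω) = x from Subtype.ext hx] at h3

/-- Near the vertex of the hyperbola, x₂² + x₃² = e^{2s+2t} + e^{2s-2t} lies between e^{2s} and
2e^{2s+1} ≤ e^{2s+2}. This is why the majorant looks back over a window of length 2. -/
theorem logNormSq_curve_mem {s t : ℝ} (ht : t ∈ Set.Icc (-(1 / 2) : ℝ) (1 / 2)) :
    2 * s ∈ Set.Icc (logNormSq (curve s t) - 2) (logNormSq (curve s t)) := by
  have e : logNormSq (curve s t) =
      Real.log (Real.exp (2 * s + 2 * t) + Real.exp (2 * s - 2 * t)) := by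
    change Real.log (Real.exp (s + t) ^ 2 + Real.exp (s - t) ^ 2) = _
    rw [← Real.exp_nat_mul, ← Real.exp_nat_mul]
    push_cast
    ring_nf
  have h2 : (2 : ℝ) ≤ Real.exp 1 := by linarith [Real.add_one_le_exp (1 : ℝ)]
  rw [e]
  constructor
  · rw [sub_le_iff_le_add, Real.log_le_iff_le_exp (by positivity)]
    have h3 : Real.exp (2 * s + 2 * t) ≤ Real.exp (2 * s + 1) :=
      Real.exp_le_exp.2 (by linarith [ht.2])
    have h4 : Real.exp (2 * s - 2 * t) ≤ Real.exp (2 * s + 1) :=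
      Real.exp_le_exp.2 (by linarith [ht.1])
    have h5 : Real.exp (2 * s + 2) = Real.exp (2 * s + 1) * Real.exp 1 := by
      rw [← Real.exp_add]; ring_nf
    rw [h5]
    nlinarith [Real.exp_pos (2 * s + 1)]
  · rw [Real.le_log_iff_exp_le (by positivity)]
    rcases le_total 0 t with h | h
    · have := Real.exp_le_exp.2 (show 2 * s ≤ 2 * s + 2 * t by linarith)
      linarith [Real.exp_pos (2 * s - 2 * t)]
    · have := Real.exp_le_exp.2 (show 2 * s ≤ 2 * s - 2 * t by linarith)
      linarith [Real.exp_pos (2 * s + 2 * t)]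

/-- The part |t| ≤ 1/2 of the arc has unit length in t and K ≥ G(2s) there; the rest contributes
nonnegatively, since K ≥ G ≥ 0. -/
theorem le_curveIntegral {K G : ℝ → ℝ} (hK : ContDiff ℝ ∞ K) (hG : ∀ s, 0 ≤ G s)
    (h : ∀ τ, ∀ s ∈ Set.Icc (τ - 2) τ, G s ≤ K τ) {s : ℝ} (hs : s ≤ -1) :
    G (2 * s) ≤ curveIntegral (fun x : Ω => K (logNormSq x)) s := by
  have hS := smooth_comp_logNormSq hK
  have hv (t : ℝ) : ext0 (fun x : Ω => K (logNormSq x)) (curve s t) = K (logNormSq (curve s t)) :=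
    ext0_coe (fun x : Ω => K (logNormSq x)) ⟨_, curve_mem_Ω s t⟩
  have h0 : G (2 * s) = ∫ _ in (-(1 / 2) : ℝ)..(1 / 2), G (2 * s) := by
    rw [intervalIntegral.integral_const]; norm_num
  calc G (2 * s) = ∫ _ in (-(1 / 2) : ℝ)..(1 / 2), G (2 * s) := h0
    _ ≤ ∫ t in (-(1 / 2) : ℝ)..(1 / 2), ext0 (fun x : Ω => K (logNormSq x)) (curve s t) := by
      refine intervalIntegral.integral_mono_on (by norm_num) intervalIntegrable_const
        ((hS.continuous_curve_right s).intervalIntegrable _ _) fun t ht => ?_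
      rw [hv]
      exact h _ _ (logNormSq_curve_mem ht)
    _ ≤ _ := by
      refine intervalIntegral.integral_mono_interval (by linarith) (by norm_num) (by linarith)
        (.of_forall fun t => ?_) ((hS.continuous_curve_right s).intervalIntegrable _ _)
      change 0 ≤ ext0 (fun x : Ω => K (logNormSq x)) (curve s t)
      rw [hv]
      exact (hG _).trans (h _ _ ⟨by linarith, le_rfl⟩)

theorem not_finite_Htan_one : ¬ Module.Finite Cas (Htan 1) := by
  rintro ⟨S, hS⟩
  choose r hr using Submodule.Quotient.mk_surjective
    ((coboundariesTan 1).submoduleOf (cocyclesTan 1))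
  -- B dominates the arc integrals of representatives of the generators; the summand 1 absorbs
  -- coboundaries and keeps B positive for the later cancellation.
  let B : ℝ → ℝ := fun s => 1 + ∑ i ∈ S, |curveIntegral (comp₀ (r i).1) s|
  have hB1 (s : ℝ) : 1 ≤ B s :=
    le_add_of_nonneg_right (Finset.sum_nonneg fun _ _ => abs_nonneg _)
  have hBc : Continuous B := continuous_const.add
    (continuous_finsetSum _ fun i _ => (continuous_curveIntegral (smooth_comp₀ _)).abs)
  have hB : (fun _ => (1 : ℝ)) =O[atBot] B :=
    IsBigO.of_norm_le fun s => by rw [norm_one]; exact hB1 s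
  have hN (A : cocyclesTan 1) : A ∈ boundedCocycles B := by
    have hmap : (⊤ : Submodule Cas (Htan 1)) ≤ (boundedCocycles B).map
        ((coboundariesTan 1).submoduleOf (cocyclesTan 1)).mkQ := by
      rw [← hS, Submodule.span_le]
      intro i hi
      refine ⟨r i, ?_, hr i⟩
      refine IsBigO.of_norm_le fun s => ?_
      have h1 := Finset.single_le_sum (f := fun i => |curveIntegral (comp₀ (r i).1) s|)
        (fun _ _ => abs_nonneg _) hi
      rw [Real.norm_eq_abs]
      exact (h1.trans (le_add_of_nonneg_left zero_le_one)).trans (le_refl (B s))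
    obtain ⟨A', hA', h⟩ := hmap (show Htan.mk A ∈ (⊤ : Submodule Cas (Htan 1)) from trivial)
    have h2 := coboundariesTan_le_boundedCocycles hB
      ((Submodule.Quotient.eq ((coboundariesTan 1).submoduleOf (cocyclesTan 1))).1 h)
    have h3 := sub_mem hA' h2
    rwa [sub_sub_cancel] at h3
  have hG0 (s : ℝ) : 0 ≤ (|s| + 1) * B (s / 2) :=
    mul_nonneg (by positivity) (zero_le_one.trans (hB1 _))
  -- The argument s/2 undoes the 2s of `le_curveIntegral`, so the arc integral of K is at least
  -- (|2s| + 1)B(s) for s ≤ -1; the unbounded factor contradicts O(B).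
  obtain ⟨K, hK, hKG⟩ := exists_smooth_majorant
    (show Continuous fun s => (|s| + 1) * B (s / 2) by fun_prop)
  have hA := hN ⟨vec₀ (smooth_comp_logNormSq hK), vec₀_mem_cocyclesTan _ (D_comp_logNormSq hK)⟩
  change curveIntegral (comp₀ (vec₀ (smooth_comp_logNormSq hK))) =O[atBot] B at hA
  have hc : comp₀ (vec₀ (smooth_comp_logNormSq hK)) = fun x : Ω => K (logNormSq x) := by
    funext x
    rw [comp₀, vec₀_val]
    simp [X]
  rw [hc] at hA
  obtain ⟨C, hC⟩ := hA.bound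
  obtain ⟨s, h1, h2, h3⟩ :=
    (hC.and ((eventually_le_atBot (-1 : ℝ)).and (eventually_le_atBot (-C)))).exists
  have h4 := le_curveIntegral hK hG0 hKG h2
  have h5 := h4.trans ((le_abs_self _).trans h1)
  rw [mul_div_cancel_left₀ s two_ne_zero, Real.norm_eq_abs,
    abs_of_nonneg (zero_le_one.trans (hB1 s))] at h5
  have h6 := le_of_mul_le_mul_right h5 (zero_lt_one.trans_le (hB1 s))
  have h7 := neg_le_abs (2 * s)
  linarith

theorem isInfDim_Htan_one : IsInfDim (Htan 1) := isInfDim_of_not_finite not_finite_Htan_one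

theorem isInfDim_H_two : IsInfDim (H 2) := by
  obtain ⟨e⟩ := nonempty_H_two
  exact isInfDim_of_not_finite fun _ => not_finite_Htan_one (Module.Finite.equiv e)

theorem isInfDim_H_one : IsInfDim (H 1) := by
  obtain ⟨e, -⟩ := exists_H_one_equiv
  refine isInfDim_of_not_finite fun _ => not_finite_Htan_one ?_
  let p : Htan 1 × Submodule.span Cas {transv} →ₗ[Cas] Htan 1 := LinearMap.fst Cas _ _
  exact Module.Finite.of_surjective (p ∘ₗ e.toLinearMap) fun a => ⟨e.symm (a, 0), congrArg p (e.apply_symm_apply _)⟩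

/-! ### Coadjoint orbits -/

theorem coad_apply (ξ : 𝔥) (x : Dual) : coad ξ x = -sharp x ξ := rfl

theorem coad_neg (ξ : 𝔥) : coad (-ξ) = -coad ξ := by
  refine ContinuousLinearMap.ext fun x => ?_
  rw [coad_apply, map_neg, neg_neg, _root_.neg_apply, coad_apply, neg_neg]

theorem coad_apply_of_notMem {x : Dual} (hx : x ∉ Ω) (ξ : 𝔥) : coad ξ x = 0 := by
  have hx : x 1 ^ 2 + x 2 ^ 2 = 0 := not_not.1 hx
  have h1 : x 1 = 0 := by nlinarith [sq_nonneg (x 1), sq_nonneg (x 2)]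
  have h2 : x 2 = 0 := by nlinarith [sq_nonneg (x 1), sq_nonneg (x 2)]
  rw [coad_apply, sharp_eq, h1, h2]
  ext i; fin_cases i <;> simp [pt]

theorem coAd_apply_of_notMem {x : Dual} (hx : x ∉ Ω) (ξ : 𝔥) : coAd ξ x = x := by
  have h := (NormedSpace.exp_series_hasSum_exp' (𝕂 := ℝ) (coad ξ)).mapL
    (ContinuousLinearMap.apply ℝ Dual x)
  refine h.unique ?_
  have h0 := hasSum_single (f := fun n : ℕ => ContinuousLinearMap.apply ℝ Dual x
    ((n.factorial : ℝ)⁻¹ • coad ξ ^ n)) 0 fun n hn => ?_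
  · simpa using h0
  · obtain ⟨m, rfl⟩ := Nat.exists_eq_succ_of_ne_zero hn
    simp [pow_succ, coad_apply_of_notMem hx]

theorem coAd_neg_apply (ξ : 𝔥) (x : Dual) : coAd (-ξ) (coAd ξ x) = x := by
  have h : coAd (-ξ) * coAd ξ = 1 := by
    let := NormedAlgebra.restrictScalars ℚ ℝ (Dual →L[ℝ] Dual)
    rw [coAd, coAd, coad_neg, ← NormedSpace.exp_add_of_commute (Commute.neg_left (Commute.refl _)),
      neg_add_cancel, NormedSpace.exp_zero]
  exact congrArg (fun L => L x) h

/-- Points off Ω are fixed by the action, so invertibility prevents a point of Ω from being moved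
onto one. -/
theorem coAd_mem_Ω {x : Dual} (hx : x ∈ Ω) (ξ : 𝔥) : coAd ξ x ∈ Ω := by
  by_contra h
  have h1 := coAd_apply_of_notMem h (-ξ)
  rw [coAd_neg_apply] at h1
  exact h (h1 ▸ hx)

theorem coadjointOrbit_subset {x : Dual} (hx : x ∈ Ω) : coadjointOrbit x ⊆ Ω := by
  rintro _ ⟨l, rfl⟩
  induction l with
  | nil => simpa using hx
  | cons ξ l ih =>
    rw [List.map_cons, List.prod_cons]
    exact coAd_mem_Ω ih ξ

theorem mem_Ω_of_orbitDim {x : Dual} (h : orbitDim x = 2) : x ∈ Ω := by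
  by_contra hx
  rw [orbitDim, show (Set.range fun ξ : 𝔥 => coad ξ x) = {0} by
    simp only [coad_apply_of_notMem hx]; exact Set.range_const, Submodule.span_zero_singleton,
    finrank_bot] at h
  omega

/-- Rank–nullity: the tangent space is the range of `sharp`, whose kernel is the line through β ≠ 0
in a 3-dimensional space. -/
theorem orbitDim_of_mem_Ω {x : Dual} (hx : x ∈ Ω) : orbitDim x = 2 := by
  have h1 : Submodule.span ℝ (Set.range fun ξ : 𝔥 => coad ξ x) =
      LinearMap.range (sharp x).toLinearMap := by
    rw [← Submodule.span_eq (LinearMap.range (sharp x).toLinearMap)]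
    congr 1
    ext y
    constructor
    · rintro ⟨ξ, rfl⟩
      exact ⟨-ξ, by simp [coad_apply]⟩
    · rintro ⟨ξ, rfl⟩
      exact ⟨-ξ, by simp [coad_apply]⟩
  have h2 : LinearMap.ker (sharp x).toLinearMap = Submodule.span ℝ {beta x} := by
    ext ξ
    rw [LinearMap.mem_ker, Submodule.mem_span_singleton]
    constructor
    · intro h
      obtain ⟨c, hc⟩ := exists_smul_beta hx h
      exact ⟨c, hc.symm⟩
    · rintro ⟨c, rfl⟩
      simp
  have hβ : beta x ≠ 0 := fun h => hx (by
    have e1 : x 2 = 0 := (beta_one x).symm.trans (by rw [h]; rfl)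
    have e2 : x 1 = 0 := (beta_two x).symm.trans (by rw [h]; rfl)
    rw [e1, e2]; norm_num)
  have h3 := (sharp x).toLinearMap.finrank_range_add_finrank_ker
  rw [h2, finrank_span_singleton hβ, Module.finrank_eq_card_basis stdBasis, Fintype.card_fin] at h3
  rw [orbitDim, h1]
  omega

theorem Ω_eq_orbits : Ω = {y | ∃ x : Dual, orbitDim x = 2 ∧ y ∈ coadjointOrbit x} := by
  ext y
  constructor
  · exact fun hy => ⟨y, orbitDim_of_mem_Ω hy, [], by simp⟩
  · rintro ⟨x, hx, hy⟩
    exact coadjointOrbit_subset (mem_Ω_of_orbitDim hx) hy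

/-! ### The equation `H_{x₁} g = a` -/

theorem abs_lt_sqrt {u : ℝ} (hu : 0 < u) (v : ℝ) : |v| < √(u ^ 2 + v ^ 2) := by
  rw [← Real.sqrt_sq_eq_abs]
  exact Real.sqrt_lt_sqrt (sq_nonneg v) (by nlinarith)

/-- With R = √(u² + v²), (R + v)(R - v) = u², so the two roots multiply to u and the cases of `phi`
merge. The merged formula is continuous up to u = 0. -/
theorem phi_eq {u : ℝ} (hu : 0 < u) (v : ℝ) :
    phi u v = (√(v + √(u ^ 2 + v ^ 2)), √(-v + √(u ^ 2 + v ^ 2))) := by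
  have h := abs_lt.1 (abs_lt_sqrt hu v)
  have hR : √(u ^ 2 + v ^ 2) ^ 2 = u ^ 2 + v ^ 2 := Real.sq_sqrt (by positivity)
  have hp : 0 < √(v + √(u ^ 2 + v ^ 2)) := Real.sqrt_pos.2 (by linarith)
  have hm : 0 < √(-v + √(u ^ 2 + v ^ 2)) := Real.sqrt_pos.2 (by linarith)
  have hmul : √(v + √(u ^ 2 + v ^ 2)) * √(-v + √(u ^ 2 + v ^ 2)) = u := by
    rw [← Real.sqrt_mul (by linarith), Real.sqrt_eq_iff_mul_self_eq_of_pos hu]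
    linear_combination -hR
  rw [phi]
  split_ifs with h1 h2
  · rw [eq_div_of_mul_eq hp.ne' ((mul_comm _ _).trans hmul)]
  · rw [eq_div_of_mul_eq hm.ne' hmul]
  · obtain rfl : v = 0 := le_antisymm (not_lt.1 h1) (not_lt.1 h2)
    simp [Real.sqrt_sq hu.le]

/-- The point `(0, φ(u, t))`. -/
noncomputable def phiPt (u t : ℝ) : Dual :=
  pt 0 (√(t + √(u ^ 2 + t ^ 2))) (√(-t + √(u ^ 2 + t ^ 2)))

theorem phiPt_mem_Ω {u : ℝ} (hu : 0 < u) (t : ℝ) : phiPt u t ∈ Ω := by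
  have h := abs_lt.1 (abs_lt_sqrt hu t)
  have hp : 0 < √(t + √(u ^ 2 + t ^ 2)) := Real.sqrt_pos.2 (by linarith)
  exact pt_mem_Ω.2 (by positivity)

theorem continuous_phiPt : Continuous fun q : ℝ × ℝ => phiPt q.1 q.2 := by
  refine continuous_pi fun i => ?_
  fin_cases i <;> simp [phiPt, pt] <;> fun_prop

/-- Along H_{x₁} the coordinate v = (x₂² - x₃²)/2 moves at speed x₂² + x₃² = 2√(u² + v²), so
parametrizing by v divides the field by this speed. -/
theorem hasDerivAt_phiPt {u : ℝ} (hu : 0 < u) (t : ℝ) :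
    HasDerivAt (phiPt u) ((2 * √(u ^ 2 + t ^ 2))⁻¹ • sharp (phiPt u t) (X 0)) t := by
  have h := abs_lt.1 (abs_lt_sqrt hu t)
  have hR : 0 < √(u ^ 2 + t ^ 2) := Real.sqrt_pos.2 (by positivity)
  have hp : 0 < √(t + √(u ^ 2 + t ^ 2)) := Real.sqrt_pos.2 (by linarith)
  have hm : 0 < √(-t + √(u ^ 2 + t ^ 2)) := Real.sqrt_pos.2 (by linarith)
  have hp2 : √(t + √(u ^ 2 + t ^ 2)) ^ 2 = t + √(u ^ 2 + t ^ 2) := Real.sq_sqrt (by linarith)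
  have hm2 : √(-t + √(u ^ 2 + t ^ 2)) ^ 2 = -t + √(u ^ 2 + t ^ 2) := Real.sq_sqrt (by linarith)
  have dR : HasDerivAt (fun t => √(u ^ 2 + t ^ 2)) (2 * t / (2 * √(u ^ 2 + t ^ 2))) t := by
    have := ((hasDerivAt_pow 2 t).const_add (u ^ 2)).sqrt (by positivity)
    simpa using this
  rw [sharp_X_zero]
  refine hasDerivAt_pi.2 fun i => ?_
  fin_cases i
  · simpa [phiPt, pt] using hasDerivAt_const t (0 : ℝ)
  · have := ((hasDerivAt_id t).add dR).sqrt (show t + √(u ^ 2 + t ^ 2) ≠ 0 by linarith)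
    simp only [phiPt, pt]
    refine this.congr_deriv ?_
    simp
    field_simp
    rw [hp2]
    ring
  · have := ((hasDerivAt_id t).neg.add dR).sqrt (show -t + √(u ^ 2 + t ^ 2) ≠ 0 by linarith)
    simp only [phiPt, pt]
    refine this.congr_deriv ?_
    simp
    field_simp
    rw [hm2]
    ring

/-- The integrand is the t-derivative of g along φ(u, ·), so the integral is a difference of
endpoint values. As u → 0⁺ the endpoints tend to (0, √2, 0) and (0, 0, √2), both in Ω, where g is
continuous. -/
theorem exists_tendsto_integral {a g : Ω → ℝ} (ha : Smooth a) (hg : Smooth g)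
    (h : ∀ x : Ω, D g x (sharp x (X 0)) = a x) :
    ∃ L : ℝ, Tendsto
      (fun u : ℝ => ∫ t in (-1 : ℝ)..1,
        ext0 a ![0, (phi u t).1, (phi u t).2] / (2 * √(u ^ 2 + t ^ 2))) (𝓝[>] 0) (𝓝 L) := by
  have key : ∀ u ∈ Set.Ioi (0 : ℝ), (∫ t in (-1 : ℝ)..1,
      ext0 a ![0, (phi u t).1, (phi u t).2] / (2 * √(u ^ 2 + t ^ 2))) =
      ext0 g (phiPt u 1) - ext0 g (phiPt u (-1)) := by
    intro u hu
    have hu : 0 < u := hu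
    have e (t : ℝ) : ext0 a ![0, (phi u t).1, (phi u t).2] / (2 * √(u ^ 2 + t ^ 2)) =
        ext0 a (phiPt u t) / (2 * √(u ^ 2 + t ^ 2)) := by rw [phi_eq hu]; rfl
    simp only [e]
    refine intervalIntegral.integral_eq_sub_of_hasDerivAt (f := fun t => ext0 g (phiPt u t))
      (fun t _ => ?_) (Continuous.intervalIntegrable ?_ _ _)
    · refine (hasDerivAt_comp_curve hg (hasDerivAt_phiPt hu t) (phiPt_mem_Ω hu t)).congr_deriv ?_
      rw [map_smul, smul_eq_mul, div_eq_inv_mul, ext0_coe a ⟨_, phiPt_mem_Ω hu t⟩, ← h]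
    · refine (ha.continuous_comp (continuous_phiPt.comp (by fun_prop : Continuous fun t => (u, t)))
        (phiPt_mem_Ω hu)).div (by fun_prop) fun t => ?_
      have : 0 < √(u ^ 2 + t ^ 2) := Real.sqrt_pos.2 (by positivity)
      positivity
  have lim (t : ℝ) (ht : phiPt 0 t ∈ Ω) :
      Tendsto (fun u => ext0 g (phiPt u t)) (𝓝[>] 0) (𝓝 (ext0 g (phiPt 0 t))) :=
    tendsto_ext0 hg ht (((continuous_phiPt.comp
      (by fun_prop : Continuous fun u => (u, t))).tendsto 0).mono_left nhdsWithin_le_nhds)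
  refine ⟨_, ((lim 1 ?_).sub (lim (-1) ?_)).congr' ?_⟩
  · exact pt_mem_Ω.2 (by norm_num)
  · exact pt_mem_Ω.2 (by norm_num)
  · filter_upwards [self_mem_nhdsWithin] with u hu using (key u hu).symm

end LiePoissonH

open LiePoissonH in
theorem mainTheorem11 :
    -- `Ω` is the union of the two-dimensional coadjoint orbits
    (Ω = {y | ∃ x : Dual, orbitDim x = 2 ∧ y ∈ coadjointOrbit x}) ∧
    -- tangential Poisson cohomology
    Nonempty (Htan 0 ≃ₗ[Cas] Cas) ∧
    IsInfDim (Htan 1) ∧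
    (∀ k, 1 < k → Subsingleton (Htan k)) ∧
    -- Poisson cohomology
    Nonempty (H 0 ≃ₗ[Cas] Cas) ∧
    (∃ e : H 1 ≃ₗ[Cas] Htan 1 × Submodule.span Cas {transv},
      (∀ A : cocyclesTan 1, e (H.mk (tanIncl 1 A)) = (Htan.mk A, 0)) ∧
      ∀ (Q : cocycles 1) (x : Ω) (ξ : 𝔥),
        (e (H.mk Q)).2.1.val x ![ξ] = Q.1.val x ![beta x] * transv.val x ![ξ]) ∧
    Nonempty (H 2 ≃ₗ[Cas] Htan 1) ∧
    IsInfDim (H 1) ∧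
    IsInfDim (H 2) ∧
    (∀ k, 2 < k → Subsingleton (H k)) ∧
    -- the necessary condition for `H_{x₁} g = a`
    (∀ a g : Ω → ℝ, Smooth a → Smooth g →
      (∀ x y : Ω, x.1 1 = y.1 1 → x.1 2 = y.1 2 → a x = a y ∧ g x = g y) →
      (∀ x : Ω, D g x (sharp x (X 0)) = a x) →
      ∃ L : ℝ, Filter.Tendsto
        (fun u : ℝ => ∫ t in (-1 : ℝ)..1,
          ext0 a ![0, (phi u t).1, (phi u t).2] / (2 * √(u ^ 2 + t ^ 2)))
        (nhdsWithin 0 (Set.Ioi 0)) (nhds L)) := by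
  exact ⟨Ω_eq_orbits, nonempty_Htan_zero, isInfDim_Htan_one, fun _ hk => subsingleton_Htan hk,
    nonempty_H_zero, exists_H_one_equiv, nonempty_H_two, isInfDim_H_one, isInfDim_H_two,
    fun _ hk => subsingleton_H hk, fun _ _ ha hg _ h => exists_tendsto_integral ha hg h⟩
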